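/- Let $n\ge 1$. For $\omega=\omega(1)\cdots\omega(n)\in S_n$, a reduction of $\omega$ is a permutation obtained from $\omega$ by interchanging some entries $\omega(i)$ and $\omega(j)$ with $i<j$ and $\omega(i)>\omega(j)$. In the (strong) Bruhat order, $\pi\le\sigma$ means that there is a chain $\sigma=\omega_1\to\omega_2\to\cdots\to\omega_s=\pi$ (with $s\ge 1$) in which each $\omega_t$, $2\le t\le s$, is a reduction of $\omega_{t-1}$. **Theorem.** There exist universal constants $c_1,c_2>0$ such that for every integer $n\ge 1$, if $\pi,\sigma\in S_n$ are selected independently and uniformly at random, then $$c_1\,(0.708)^n\;\le\; P(\pi\le\sigma)\;\le\;\frac{c_2}{n^2}.$$ -/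

import Mathlib

/-- `ω'` is a reduction of `ω = ω(1) ⋯ ω(n)`: it is obtained from `ω` by interchanging the entries
`ω(i)` and `ω(j)` for some `i < j` with `ω(i) > ω(j)`. The ground set `{1, …, n}` is `Fin n`. -/
def IsReduction {n : ℕ} (ω ω' : Equiv.Perm (Fin n)) : Prop :=
  ∃ i j : Fin n, i < j ∧ ω j < ω i ∧ ω' = ω * Equiv.swap i j

/-- The (strong) Bruhat order: `π ≤ σ` if there is a (possibly trivial) chain
`σ = ω₁ → ω₂ → ⋯ → ωₛ = π` in which each term is a reduction of the one before it. -/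
def BruhatLE {n : ℕ} (π σ : Equiv.Perm (Fin n)) : Prop :=
  Relation.ReflTransGen IsReduction σ π

/-- The finite set `S_n` carries the discrete σ-algebra. -/
instance permMeasurableSpace (n : ℕ) : MeasurableSpace (Equiv.Perm (Fin n)) := ⊤

instance permDiscreteMeasurableSpace (n : ℕ) : DiscreteMeasurableSpace (Equiv.Perm (Fin n)) :=
  ⟨fun _ => trivial⟩

/-- The random permutation `X` of `{1, …, n}` is uniform on `S_n`: it is measurable and its law is
the uniform probability measure. -/
def IsUniformPerm {n : ℕ} {Ω : Type*} [MeasurableSpace Ω] (P : MeasureTheory.Measure Ω)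
    (X : Ω → Equiv.Perm (Fin n)) : Prop :=
  Measurable X ∧ P.map X = ProbabilityTheory.uniformOn Set.univ

/-!
Write `cornerCount π i j` for the number of positions `a < i` with `π a < j`. By the rank-matrix
criterion, `π ≤ σ` in the strong Bruhat order if and only if every corner contains at least as many
points of `π` as of `σ` (`bruhatLE_iff_cornerLE`). Both bounds are therefore statements about the
proportion `comparableRatio n` of pairs satisfying this family of inequalities.

*Lower bound.* Suppose that the first `k` entries of two permutations of `Fin (k + n)` satisfy the
corner inequalities among themselves and that the patterns of the remaining entries are comparable.
Then the permutations are comparable (`CornerLE.prefixPerm`), since corner counts of a pattern grow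
by at most one per column. Cut the values into `M + 1` cells of equal length and place the prefix of
`π` in the first `M` cells along a word `u`, that of `σ` in the last `M` cells along a word `v`
shifted by one cell. It is then enough that `#{l < i | v l < c} ≤ #{l < i | u l < c}` for all `i` and
`c`. For fixed `c` this says that a centred walk with steps in `{-1, 0, 1}` stays nonnegative, which
has probability at least `1 / (k + 1)` because height plus one is a martingale for the walk killed at
`-1` (`card_staysNonneg_ge`). For different `c` these events are all increasing for one product
order, so by the FKG inequality their intersection has probability at least `(k + 1) ^ -(M + 1)`
(`card_dominant_words_ge`). The cells cost a factor `(M / (M + 1)) ^ 2` per entry. With `M = 6` this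
is `36 / 49 > 0.708`, and the polynomial loss is absorbed by a long block (`exists_block_length`).

*Upper bound.* Split the positions and the values into halves of sizes `m` and `m'`, and keep only
the corner inequalities for corners of width `m` or of height `m`. Let `r` and `s` be the numbers of
points of `π` and `σ` in the top-left quadrant. Given `r` and `s`, the sets of positions in either
half that carry a small value, and of values in either half that sit at a small position, are
independent uniform subsets of known sizes, and the inequalities split into four ballot problems.
By reflection, the probability is `(m + 1) (r - s + 1) / ((r + 1) (m - s + 1))` for the first half
(`card_ballotWords_mul_le`) and similarly for the second, hence of order `(r - s + 1) / n` for typical `r` and `s`. So the probability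
of comparability is of order at most the expectation of `(r - s + 1) ^ 4 / n ^ 4`. Both counts are
hypergeometric with fourth central moment `O(n ^ 2)`, by Stein's identity
(`sum_hyperWeight_dev_four_le`), which leaves `O(n ^ -2)`.
-/

open Finset

/-! ### The rank-matrix criterion for the Bruhat order -/

/-- The number of points of the graph of `π` in the top-left `i × j` corner, that is, the number of
positions `a < i` with `π a < j`. -/
def cornerCount {n : ℕ} (π : Equiv.Perm (Fin n)) (i j : ℕ) : ℕ :=
  #{a : Fin n | a.val < i ∧ (π a).val < j}

/-- The rank-matrix form of the Bruhat order: every top-left corner contains at least as many points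
of the graph of `π` as of the graph of `σ`. -/
def CornerLE {n : ℕ} (π σ : Equiv.Perm (Fin n)) : Prop :=
  ∀ i j : ℕ, cornerCount σ i j ≤ cornerCount π i j

lemma CornerLE.refl {n : ℕ} (π : Equiv.Perm (Fin n)) : CornerLE π π := fun _ _ => le_rfl

lemma CornerLE.trans {n : ℕ} {π σ τ : Equiv.Perm (Fin n)} (h₁ : CornerLE π σ)
    (h₂ : CornerLE σ τ) : CornerLE π τ := fun i j => (h₂ i j).trans (h₁ i j)

/-- A corner containing both swapped positions keeps its count. -/
lemma cornerCount_mul_swap_of_lt {n : ℕ} (σ : Equiv.Perm (Fin n)) {a b : Fin n} (hab : a < b)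
    {i : ℕ} (hi : b.val < i) (j : ℕ) :
    cornerCount (σ * Equiv.swap a b) i j = cornerCount σ i j := by
  have hlt : ∀ c : Fin n, c.val < i → (Equiv.swap a b c).val < i := by
    intro c hc
    rw [Equiv.swap_apply_def]
    split_ifs
    · exact hi
    · exact lt_trans hab hi
    · exact hc
  unfold cornerCount
  refine Finset.card_bij' (fun c _ => Equiv.swap a b c) (fun c _ => Equiv.swap a b c) ?_ ?_ ?_ ?_
  · intro c hc
    simp only [mem_filter, mem_univ, true_and] at hc ⊢
    simp only [Equiv.Perm.mul_apply] at hc ⊢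
    exact ⟨hlt c hc.1, hc.2⟩
  · intro c hc
    simp only [mem_filter, mem_univ, true_and] at hc ⊢
    rw [Equiv.Perm.mul_apply, Equiv.swap_apply_self]
    exact ⟨hlt c hc.1, hc.2⟩
  · intro c _; simp
  · intro c _; simp

lemma IsReduction.cornerLE {n : ℕ} {ω ω' : Equiv.Perm (Fin n)} (h : IsReduction ω ω') :
    CornerLE ω' ω := by
  obtain ⟨a, b, hab, hω, rfl⟩ := h
  intro i j
  rcases lt_or_ge b.val i with hi | hi
  · exact (cornerCount_mul_swap_of_lt ω hab hi j).ge
  · unfold cornerCount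
    apply card_le_card
    intro c hc
    simp only [mem_filter, mem_univ, true_and] at hc ⊢
    simp only [Equiv.Perm.mul_apply] at hc ⊢
    refine ⟨hc.1, ?_⟩
    by_cases hca : c = a
    · subst hca
      rw [Equiv.swap_apply_left]
      exact lt_trans hω hc.2
    · rw [Equiv.swap_apply_of_ne_of_ne hca]
      · exact hc.2
      · rintro rfl
        exact absurd hc.1 (by omega)

lemma BruhatLE.cornerLE {n : ℕ} {π σ : Equiv.Perm (Fin n)} (h : BruhatLE π σ) :
    CornerLE π σ := by
  unfold BruhatLE at h
  induction h with
  | refl => exact CornerLE.refl σ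
  | tail _ h ih => exact h.cornerLE.trans ih

/-- At the first position where two comparable permutations differ, the smaller one has the smaller
entry. -/
lemma CornerLE.exists_first_diff {n : ℕ} {π σ : Equiv.Perm (Fin n)} (h : CornerLE π σ)
    (hne : π ≠ σ) : ∃ a, (∀ c < a, π c = σ c) ∧ π a < σ a := by
  classical
  have hex : (univ.filter fun a => π a ≠ σ a).Nonempty := by
    by_contra hcon
    rw [not_nonempty_iff_eq_empty, filter_eq_empty_iff] at hcon
    exact hne (Equiv.ext fun a => not_not.1 (hcon (mem_univ a)))
  obtain ⟨a, ha, hmin⟩ := exists_min_image _ id hex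
  simp only [mem_filter, mem_univ, true_and, id] at ha hmin
  have hlow : ∀ c < a, π c = σ c := fun c hc => by
    by_contra hcon
    exact absurd (hmin c hcon) (not_le.2 hc)
  refine ⟨a, hlow, lt_of_le_of_ne ?_ ha⟩
  by_contra! hlt
  -- Otherwise the corner of height `a + 1` and width `σ a + 1` has one more point for `σ`.
  have hle := h (a.val + 1) ((σ a).val + 1)
  have hss : (univ.filter fun c : Fin n => c.val < a.val + 1 ∧ (π c).val < (σ a).val + 1) ⊂
      univ.filter fun c : Fin n => c.val < a.val + 1 ∧ (σ c).val < (σ a).val + 1 := by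
    rw [ssubset_iff_of_subset]
    · refine ⟨a, by simp, ?_⟩
      simp only [mem_filter, mem_univ, true_and, not_and, not_lt]
      intro _
      have : (σ a).val < (π a).val := hlt
      omega
    · intro c hc
      simp only [mem_filter, mem_univ, true_and] at hc ⊢
      rcases lt_or_ge c a with hca | hca
      · rw [← hlow c hca]; exact hc
      · have : c = a := le_antisymm (by have := hc.1; exact Fin.le_def.2 (by omega)) hca
        subst this
        simp
  exact absurd hle (not_le.2 (card_lt_card hss))

lemma CornerLE.antisymm {n : ℕ} {π σ : Equiv.Perm (Fin n)} (h₁ : CornerLE π σ)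
    (h₂ : CornerLE σ π) : π = σ := by
  by_contra hne
  obtain ⟨a, ha, hlt⟩ := h₁.exists_first_diff hne
  obtain ⟨b, hb, hlt'⟩ := h₂.exists_first_diff (Ne.symm hne)
  rcases lt_trichotomy a b with h | h | h
  · exact absurd (hb a h) hlt.ne'
  · subst h; exact absurd hlt hlt'.asymm
  · exact absurd (ha b h) hlt'.ne'

lemma cornerCount_split {n : ℕ} (π : Equiv.Perm (Fin n)) (i : ℕ) {t j : ℕ} (h : t ≤ j) :
    cornerCount π i j =
      cornerCount π i t + #{c : Fin n | c.val < i ∧ t ≤ (π c).val ∧ (π c).val < j} := by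
  unfold cornerCount
  rw [← card_union_of_disjoint]
  · congr 1
    ext c
    simp only [mem_filter, mem_univ, true_and, mem_union]
    omega
  · rw [disjoint_left]
    intro c hc hc'
    simp only [mem_filter, mem_univ, true_and] at hc hc'
    omega

/-- The exchange step behind the rank-matrix criterion: if `π` lies strictly below `σ` in the corner
order, some reduction of `σ` still lies above `π`. The reduction swaps the first position `a` where
`π` and `σ` differ with the first later position whose `σ`-entry lies in `[π a, σ a)`. -/
lemma CornerLE.exists_reduction {n : ℕ} {π σ : Equiv.Perm (Fin n)} (h : CornerLE π σ)
    (hne : π ≠ σ) : ∃ σ', IsReduction σ σ' ∧ CornerLE π σ' := by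
  classical
  obtain ⟨a, hlow, hlt⟩ := h.exists_first_diff hne
  have hex : (univ.filter fun b => a < b ∧ π a ≤ σ b ∧ σ b < σ a).Nonempty := by
    refine ⟨σ.symm (π a), ?_⟩
    simp only [mem_filter, mem_univ, true_and, Equiv.apply_symm_apply, le_refl, hlt, and_true]
    by_contra! hle
    rcases hle.lt_or_eq with hl | he
    · have := hlow _ hl
      rw [Equiv.apply_symm_apply] at this
      exact absurd (π.injective this) hl.ne
    · rw [← he, Equiv.apply_symm_apply] at hlt
      rw [he] at hlt
      exact lt_irrefl _ hlt
  obtain ⟨b, hb, hmin⟩ := exists_min_image _ id hex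
  simp only [mem_filter, mem_univ, true_and, id] at hb hmin
  obtain ⟨hab, hπb, hba⟩ := hb
  refine ⟨σ * Equiv.swap a b, ⟨a, b, hab, hba, rfl⟩, ?_⟩
  intro i j
  rcases lt_or_ge b.val i with hi | hi
  · rw [cornerCount_mul_swap_of_lt σ hab hi j]; exact h i j
  by_cases hin : a.val < i ∧ (σ b).val < j ∧ j ≤ (σ a).val
  · obtain ⟨hai, hbj, hja⟩ := hin
    have h₁ : cornerCount (σ * Equiv.swap a b) i j ≤ cornerCount σ i j + 1 := by
      unfold cornerCount
      refine (card_le_card ?_).trans (card_insert_le a _)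
      intro c hc
      simp only [mem_filter, mem_univ, true_and, mem_insert] at hc ⊢
      simp only [Equiv.Perm.mul_apply] at hc ⊢
      by_cases hca : c = a
      · exact Or.inl hca
      · rw [Equiv.swap_apply_of_ne_of_ne hca] at hc
        · exact Or.inr hc
        · rintro rfl; exact absurd hc.1 (by omega)
    have hπj : (π a).val ≤ j := by have : (π a).val ≤ (σ b).val := hπb; omega
    have h₂ : #{c : Fin n | c.val < i ∧ (π a).val ≤ (σ c).val ∧ (σ c).val < j} + 1 ≤
        #{c : Fin n | c.val < i ∧ (π a).val ≤ (π c).val ∧ (π c).val < j} := by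
      rw [← card_insert_of_notMem (a := a)]
      · apply card_le_card
        intro c hc
        simp only [mem_filter, mem_univ, true_and, mem_insert] at hc ⊢
        rcases hc with rfl | ⟨hc₁, hc₂, hc₃⟩
        · refine ⟨hai, le_rfl, ?_⟩
          have : (π c).val ≤ (σ b).val := hπb
          omega
        · rcases lt_trichotomy c a with hca | hca | hca
          · rw [hlow c hca]; exact ⟨hc₁, hc₂, hc₃⟩
          · subst hca; omega
          · have hbc := hmin c ⟨hca, hc₂, Fin.lt_def.2 (by omega)⟩
            have : b.val ≤ c.val := hbc
            omega
      · simp only [mem_filter, mem_univ, true_and, not_and, not_lt]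
        intros; exact hja
    rw [cornerCount_split π i hπj]
    rw [cornerCount_split σ i hπj] at h₁
    have := h i (π a).val
    omega
  · refine le_trans ?_ (h i j)
    unfold cornerCount
    apply card_le_card
    intro c hc
    simp only [mem_filter, mem_univ, true_and] at hc ⊢
    simp only [Equiv.Perm.mul_apply] at hc ⊢
    refine ⟨hc.1, ?_⟩
    by_cases hca : c = a
    · subst hca
      rw [Equiv.swap_apply_left] at hc
      by_contra hcon
      exact hin ⟨hc.1, hc.2, by omega⟩
    · rw [Equiv.swap_apply_of_ne_of_ne hca] at hc
      · exact hc.2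
      · rintro rfl; exact absurd hc.1 (by omega)

lemma CornerLE.bruhatLE {n : ℕ} {π σ : Equiv.Perm (Fin n)} (h : CornerLE π σ) :
    BruhatLE π σ := by
  let R : Equiv.Perm (Fin n) → Equiv.Perm (Fin n) → Prop := fun x y => CornerLE x y ∧ x ≠ y
  have : IsTrans _ R := ⟨fun x y z hxy hyz =>
    ⟨hxy.1.trans hyz.1, by rintro rfl; exact hxy.2 (hxy.1.antisymm hyz.1)⟩⟩
  have : Std.Irrefl R := ⟨fun x hx => hx.2 rfl⟩
  have wf : WellFounded R := Finite.wellFounded_of_trans_of_irrefl R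
  revert h
  induction σ using wf.induction with
  | _ σ ih =>
    intro h
    by_cases hne : π = σ
    · subst hne; exact Relation.ReflTransGen.refl
    obtain ⟨σ', hred, hle⟩ := h.exists_reduction hne
    refine Relation.ReflTransGen.head hred (ih σ' ⟨hred.cornerLE, ?_⟩ hle)
    obtain ⟨a, b, hab, -, rfl⟩ := hred
    intro he
    rw [mul_eq_left, Equiv.swap_eq_one_iff] at he
    exact hab.ne he

/-- The rank-matrix (tableau) criterion for the strong Bruhat order. -/
theorem bruhatLE_iff_cornerLE {n : ℕ} {π σ : Equiv.Perm (Fin n)} :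
    BruhatLE π σ ↔ CornerLE π σ := ⟨BruhatLE.cornerLE, CornerLE.bruhatLE⟩

/-! ### Reduction to counting -/

open Classical in
/-- The number of comparable pairs of permutations of `Fin n`. -/
noncomputable def comparablePairs (n : ℕ) : ℕ :=
  #{p : Equiv.Perm (Fin n) × Equiv.Perm (Fin n) | CornerLE p.1 p.2}

lemma IsUniformPerm.measureReal_singleton {n : ℕ} {Ω : Type*} [MeasurableSpace Ω]
    {P : MeasureTheory.Measure Ω} {X : Ω → Equiv.Perm (Fin n)} (hX : IsUniformPerm P X)
    (τ : Equiv.Perm (Fin n)) : P.real (X ⁻¹' {τ}) = 1 / (n.factorial : ℝ) := by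
  have h := congrArg (fun μ => μ {τ}) hX.2
  rw [MeasureTheory.Measure.map_apply hX.1 (MeasurableSet.of_discrete),
    ProbabilityTheory.uniformOn_univ, MeasureTheory.Measure.count_singleton,
    Fintype.card_perm, Fintype.card_fin] at h
  rw [MeasureTheory.measureReal_def, h]
  simp

/-- The probability in question is a ratio of counts. -/
lemma measureReal_bruhatLE {n : ℕ} {Ω : Type*} [MeasurableSpace Ω]
    {P : MeasureTheory.Measure Ω} [MeasureTheory.IsProbabilityMeasure P]
    {π σ : Ω → Equiv.Perm (Fin n)} (hπ : IsUniformPerm P π) (hσ : IsUniformPerm P σ)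
    (hind : ProbabilityTheory.IndepFun π σ P) :
    P.real {x | BruhatLE (π x) (σ x)} = comparablePairs n / (n.factorial : ℝ) ^ 2 := by
  classical
  have hset : {x | BruhatLE (π x) (σ x)} = (fun x => (π x, σ x)) ⁻¹'
      (({p : Equiv.Perm (Fin n) × Equiv.Perm (Fin n) | CornerLE p.1 p.2} : Finset _) :
        Set (Equiv.Perm (Fin n) × Equiv.Perm (Fin n))) := by
    ext x
    simp [bruhatLE_iff_cornerLE]
  have hpre : ∀ p : Equiv.Perm (Fin n) × Equiv.Perm (Fin n),
      (fun x => (π x, σ x)) ⁻¹' {p} = π ⁻¹' {p.1} ∩ σ ⁻¹' {p.2} := by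
    intro p; ext x; simp [Prod.ext_iff]
  rw [hset, ← MeasureTheory.sum_measureReal_preimage_singleton]
  · have hterm : ∀ p : Equiv.Perm (Fin n) × Equiv.Perm (Fin n),
        P.real ((fun x => (π x, σ x)) ⁻¹' {p}) = 1 / (n.factorial : ℝ) ^ 2 := by
      intro p
      rw [hpre, MeasureTheory.measureReal_def,
        hind.meas_inter ⟨{p.1}, trivial, rfl⟩ ⟨{p.2}, trivial, rfl⟩, ENNReal.toReal_mul,
        ← MeasureTheory.measureReal_def, ← MeasureTheory.measureReal_def,
        hπ.measureReal_singleton, hσ.measureReal_singleton]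
      field_simp
    rw [Finset.sum_congr rfl fun p _ => hterm p, Finset.sum_const, nsmul_eq_mul,
      comparablePairs]
    ring
  · intro p _
    rw [hpre]
    exact (hπ.1 trivial).inter (hσ.1 trivial)

/-! ### Words whose walk stays nonnegative -/

/-- The height after `i` steps of the walk on `ℤ` that reads the word `w` and moves by `φ x` at the
letter `x`. For `i` beyond the length of `w` this is the final height. -/
def walkHeight {ι : Type*} {k : ℕ} (φ : ι → ℤ) (w : Fin k → ι) (i : ℕ) : ℤ :=
  ∑ l, if l.val < i then φ (w l) else 0

/-- The walk driven by `w` never goes below `0`. -/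
def StaysNonneg {ι : Type*} {k : ℕ} (φ : ι → ℤ) (w : Fin k → ι) : Prop :=
  ∀ i, 0 ≤ walkHeight φ w i

lemma walkHeight_of_le {ι : Type*} {k : ℕ} (φ : ι → ℤ) (w : Fin k → ι) {i : ℕ} (h : k ≤ i) :
    walkHeight φ w i = ∑ l, φ (w l) :=
  sum_congr rfl fun l _ => if_pos (l.isLt.trans_le h)

lemma walkHeight_snoc {ι : Type*} {k : ℕ} (φ : ι → ℤ) (w : Fin k → ι) (x : ι) (i : ℕ) :
    walkHeight φ (Fin.snoc (α := fun _ => ι) w x : Fin (k + 1) → ι) i =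
      walkHeight φ w i + if k < i then φ x else 0 := by
  simp [walkHeight, Fin.sum_univ_castSucc]

lemma staysNonneg_snoc {ι : Type*} {k : ℕ} (φ : ι → ℤ) (w : Fin k → ι) (x : ι) :
    StaysNonneg φ (Fin.snoc (α := fun _ => ι) w x : Fin (k + 1) → ι) ↔
      StaysNonneg φ w ∧ 0 ≤ ∑ l, φ (w l) + φ x := by
  constructor
  · intro h
    constructor
    · intro i
      rcases le_or_gt i k with hi | hi
      · simpa [walkHeight_snoc, not_lt.2 hi] using h i
      · have := h k
        rw [walkHeight_snoc, if_neg (lt_irrefl k), add_zero, walkHeight_of_le φ w le_rfl] at this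
        rwa [walkHeight_of_le φ w hi.le]
    · have := h (k + 1)
      rwa [walkHeight_snoc, if_pos (Nat.lt_succ_self k),
        walkHeight_of_le φ w (Nat.le_succ k)] at this
  · rintro ⟨h, hx⟩ i
    rw [walkHeight_snoc]
    split_ifs with hi
    · rwa [walkHeight_of_le φ w hi.le]
    · rw [add_zero]; exact h i

lemma sum_words_snoc {ι M : Type*} [Fintype ι] [AddCommMonoid M] {k : ℕ}
    (f : (Fin (k + 1) → ι) → M) :
    ∑ w, f w = ∑ w : Fin k → ι, ∑ x, f (Fin.snoc (α := fun _ => ι) w x) := by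
  rw [← (Fin.snocEquiv (fun _ => ι)).sum_comp, Fintype.sum_prod_type_right]
  rfl

open Classical in
/-- Height plus one is a martingale for the walk killed on its first visit to `-1`. -/
lemma sum_staysNonneg_height {ι : Type*} [Fintype ι] (φ : ι → ℤ) (h0 : ∑ x, φ x = 0)
    (h1 : ∀ x, -1 ≤ φ x) (k : ℕ) :
    ∑ w : Fin k → ι, (if StaysNonneg φ w then ∑ l, φ (w l) + 1 else 0) =
      (Fintype.card ι : ℤ) ^ k := by
  induction k with
  | zero => simp [StaysNonneg, walkHeight]
  | succ k ih =>
    rw [sum_words_snoc, pow_succ, ← ih, sum_mul]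
    refine sum_congr rfl fun w _ => ?_
    by_cases hw : StaysNonneg φ w
    · have hpos : 0 ≤ ∑ l, φ (w l) := by
        rw [← walkHeight_of_le φ w le_rfl]; exact hw k
      have hterm : ∀ x, (if StaysNonneg φ (Fin.snoc (α := fun _ => ι) w x : Fin (k + 1) → ι) then
          ∑ l, φ ((Fin.snoc (α := fun _ => ι) w x : Fin (k + 1) → ι) l) + 1 else 0) =
          (∑ l, φ (w l) + 1) + φ x := by
        intro x
        have := h1 x
        rw [staysNonneg_snoc]
        simp only [hw, true_and, Fin.sum_univ_castSucc, Fin.snoc_castSucc, Fin.snoc_last]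
        -- A killed word ends at height exactly `-1`, where the weight vanishes.
        split_ifs <;> linarith
      simp only [hterm, hw, if_true, sum_add_distrib, h0, sum_const, card_univ, nsmul_eq_mul]
      ring
    · simp [staysNonneg_snoc, hw]

open Classical in
/-- A centred walk with steps in `{-1, 0, 1}` stays nonnegative for `k` steps with probability at
least `1 / (k + 1)`. -/
lemma card_staysNonneg_ge {ι : Type*} [Fintype ι] (φ : ι → ℤ) (h0 : ∑ x, φ x = 0)
    (h1 : ∀ x, -1 ≤ φ x) (h2 : ∀ x, φ x ≤ 1) (k : ℕ) :
    Fintype.card ι ^ k ≤ (k + 1) * #{w : Fin k → ι | StaysNonneg φ w} := by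
  zify
  rw [← sum_staysNonneg_height φ h0 h1 k, card_filter]
  push_cast
  rw [mul_sum]
  refine sum_le_sum fun w _ => ?_
  split_ifs
  · have : ∑ l, φ (w l) ≤ ∑ _l : Fin k, 1 := sum_le_sum fun l _ => h2 (w l)
    simp at this
    linarith
  · simp

/-! ### Positive correlation of monotone events -/

/-- The FKG inequality for the uniform measure and several monotone functions. -/
lemma prod_mean_le_mean_prod {α ι : Type*} [DistribLattice α] [Fintype α] [Nonempty α]
    (f : ι → α → ℝ) (h0 : ∀ i x, 0 ≤ f i x) (hf : ∀ i, Monotone (f i)) (s : Finset ι) :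
    ∏ i ∈ s, ((∑ x, f i x) / Fintype.card α) ≤ (∑ x, ∏ i ∈ s, f i x) / Fintype.card α := by
  classical
  have hα : (0 : ℝ) < Fintype.card α := by exact_mod_cast Fintype.card_pos
  induction s using Finset.induction_on with
  | empty => simp [hα.ne']
  | insert i s hi ih =>
    simp only [prod_insert hi]
    have hmono : Monotone fun x => ∏ j ∈ s, f j x := fun x y hxy =>
      prod_le_prod (fun j _ => h0 j x) fun j _ => hf j hxy
    have key := fkg (f i) (fun x => ∏ j ∈ s, f j x) (fun _ => (1 : ℝ)) (fun _ => zero_le_one)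
      (h0 i) (fun x => prod_nonneg fun j _ => h0 j x) (hf i) hmono (fun _ _ => le_rfl)
    simp only [one_mul, sum_const, card_univ, nsmul_eq_mul, mul_one] at key
    calc (∑ x, f i x) / Fintype.card α * ∏ j ∈ s, ((∑ x, f j x) / Fintype.card α)
        ≤ (∑ x, f i x) / Fintype.card α * ((∑ x, ∏ j ∈ s, f j x) / Fintype.card α) :=
          mul_le_mul_of_nonneg_left ih (div_nonneg (sum_nonneg fun x _ => h0 i x) hα.le)
      _ = ((∑ x, f i x) * ∑ x, ∏ j ∈ s, f j x) / Fintype.card α / Fintype.card α := by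
          field_simp
      _ ≤ (∑ x, f i x * ∏ j ∈ s, f j x) / Fintype.card α := by
          rw [div_le_div_iff_of_pos_right hα, div_le_iff₀ hα, mul_comm _ (Fintype.card α : ℝ)]
          exact key

/-! ### Pairs of words with prefix dominance -/

/-- The step recording, at the threshold `c`, a pair of letters `(v, rev u)`: it counts `u < c`
against `v < c`. The letter `u` is stored reversed so that the step is monotone in both
coordinates. -/
def thresholdStep {M : ℕ} (c : ℕ) (x : Fin M × Fin M) : ℤ :=
  (if x.2.rev.val < c then 1 else 0) - if x.1.val < c then 1 else 0

lemma thresholdStep_mono {M : ℕ} (c : ℕ) : Monotone (thresholdStep (M := M) c) := by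
  rintro ⟨a, b⟩ ⟨a', b'⟩ ⟨h1, h2⟩
  have h1' : a.val ≤ a'.val := h1
  have h2' : b'.rev.val ≤ b.rev.val := Fin.rev_le_rev.2 h2
  simp only [thresholdStep]
  split_ifs <;> omega

lemma sum_thresholdStep {M : ℕ} (c : ℕ) : ∑ x, thresholdStep (M := M) c x = 0 := by
  simp only [thresholdStep, sum_sub_distrib, Fintype.sum_prod_type]
  rw [sub_eq_zero, sum_comm]
  exact Equiv.sum_comp Fin.revPerm fun b : Fin M => ∑ _a : Fin M, if b.val < c then (1 : ℤ) else 0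

lemma staysNonneg_thresholdStep_mono {M k c : ℕ} {w w' : Fin k → Fin M × Fin M} (h : w ≤ w')
    (hw : StaysNonneg (thresholdStep c) w) : StaysNonneg (thresholdStep c) w' := by
  intro i
  refine (hw i).trans (sum_le_sum fun l _ => ?_)
  split_ifs
  · exact thresholdStep_mono c (h l)
  · exact le_rfl

open Classical in
/-- Pairs of words in `M` letters with prefix dominance at every threshold have probability at
least polynomially small in the length. -/
lemma card_dominant_words_ge (M k : ℕ) [NeZero M] :
    ((M : ℝ) ^ 2) ^ k / ((k : ℝ) + 1) ^ (M + 1) ≤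
      #{w : Fin k → Fin M × Fin M | ∀ c ∈ range (M + 1), StaysNonneg (thresholdStep c) w} := by
  set α := Fin k → Fin M × Fin M
  have hcard : (Fintype.card α : ℝ) = ((M : ℝ) ^ 2) ^ k := by
    simp [α, sq]
  have hM : (0 : ℝ) < M := by exact_mod_cast NeZero.pos M
  have hpos : (0 : ℝ) < Fintype.card α := by rw [hcard]; positivity
  let f : ℕ → α → ℝ := fun c w => if StaysNonneg (thresholdStep c) w then 1 else 0
  have hf : ∀ c, Monotone (f c) := by
    intro c w w' h
    by_cases hw : StaysNonneg (thresholdStep c) w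
    · simp [f, hw, staysNonneg_thresholdStep_mono h hw]
    · simp only [f, hw, if_false]; split_ifs <;> norm_num
  have h0 : ∀ c w, 0 ≤ f c w := fun c w => by simp only [f]; split_ifs <;> norm_num
  have key := prod_mean_le_mean_prod f h0 hf (range (M + 1))
  have hone : ∀ c, 1 / ((k : ℝ) + 1) ≤ (∑ w, f c w) / Fintype.card α := by
    intro c
    have h := card_staysNonneg_ge (thresholdStep (M := M) c) (sum_thresholdStep c)
      (fun x => by simp only [thresholdStep]; split_ifs <;> norm_num)
      (fun x => by simp only [thresholdStep]; split_ifs <;> norm_num) k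
    have h' : (Fintype.card α : ℝ) ≤ (k + 1) * ∑ w, f c w := by
      simp only [f, sum_boole]
      rw [hcard]
      have h2 : ((Fintype.card (Fin M × Fin M) ^ k : ℕ) : ℝ) = ((M : ℝ) ^ 2) ^ k := by simp [sq]
      rw [← h2]
      exact_mod_cast h
    rw [div_le_div_iff₀ (by positivity) hpos]
    linarith
  have hprod : (1 / ((k : ℝ) + 1)) ^ (M + 1) ≤
      ∏ c ∈ range (M + 1), ((∑ w, f c w) / Fintype.card α) := by
    rw [← card_range (M + 1), ← prod_const, card_range]
    exact prod_le_prod (fun _ _ => by positivity) fun c _ => hone c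
  have hsum : ∑ w, ∏ c ∈ range (M + 1), f c w =
      #{w : α | ∀ c ∈ range (M + 1), StaysNonneg (thresholdStep c) w} := by
    rw [card_filter]
    push_cast
    refine sum_congr rfl fun w _ => ?_
    simp only [f]
    rw [prod_ite_zero]
    simp
  rw [hsum] at key
  have := hprod.trans key
  rw [le_div_iff₀ hpos, hcard] at this
  calc _ = (1 / ((k : ℝ) + 1)) ^ (M + 1) * ((M : ℝ) ^ 2) ^ k := by
        rw [div_pow, one_pow]; ring
    _ ≤ _ := this

/-! ### Prefixing a pattern by a block of values -/

/-- The number of indices `l < i` with `p l < j`. -/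
def prefixHits {k N : ℕ} (p : Fin k → Fin N) (i j : ℕ) : ℕ :=
  #{l : Fin k | l.val < i ∧ (p l).val < j}

/-- The increasing enumeration of the values missed by `p`. -/
def missedValues {k n : ℕ} (p : Fin k ↪ Fin (k + n)) : Fin n ↪o Fin (k + n) :=
  (univ.map p)ᶜ.orderEmbOfFin (by simp [card_compl])

lemma missedValues_ne {k n : ℕ} (p : Fin k ↪ Fin (k + n)) (b : Fin n) (l : Fin k) :
    missedValues p b ≠ p l := by
  have h := (univ.map p)ᶜ.orderEmbOfFin_mem (k := n) (by simp [card_compl]) b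
  simp only [mem_compl, mem_map, mem_univ, true_and, not_exists] at h
  exact fun he => h l he.symm

/-- The permutation of `Fin (k + n)` whose first `k` entries are `p` and whose remaining entries are
in the relative order `τ`. -/
noncomputable def prefixPerm {k n : ℕ} (p : Fin k ↪ Fin (k + n)) (τ : Equiv.Perm (Fin n)) :
    Equiv.Perm (Fin (k + n)) :=
  Equiv.ofBijective (Fin.append p fun b => missedValues p (τ b)) <| by
    rw [← Finite.injective_iff_bijective]
    intro a b
    refine Fin.addCases (fun a => ?_) (fun a => ?_) a <;>
      refine Fin.addCases (fun b => ?_) (fun b => ?_) b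
    · simp only [Fin.append_left]
      exact fun h => congrArg _ (p.injective h)
    · simp only [Fin.append_left, Fin.append_right]
      exact fun h => absurd h.symm (missedValues_ne p _ _)
    · simp only [Fin.append_left, Fin.append_right]
      exact fun h => absurd h (missedValues_ne p _ _)
    · simp only [Fin.append_right]
      exact fun h => congrArg _ (τ.injective ((missedValues p).injective h))

lemma prefixPerm_castAdd {k n : ℕ} (p : Fin k ↪ Fin (k + n)) (τ : Equiv.Perm (Fin n))
    (l : Fin k) : prefixPerm p τ (Fin.castAdd n l) = p l :=
  Fin.append_left p (fun b => missedValues p (τ b)) l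

lemma prefixPerm_natAdd {k n : ℕ} (p : Fin k ↪ Fin (k + n)) (τ : Equiv.Perm (Fin n))
    (b : Fin n) : prefixPerm p τ (Fin.natAdd k b) = missedValues p (τ b) :=
  Fin.append_right p (fun b => missedValues p (τ b)) b

lemma prefixPerm_injective {k n : ℕ} {p q : Fin k ↪ Fin (k + n)} {τ τ' : Equiv.Perm (Fin n)}
    (h : prefixPerm p τ = prefixPerm q τ') : p = q ∧ τ = τ' := by
  have hpq : p = q := by
    ext l
    rw [← prefixPerm_castAdd p τ, h, prefixPerm_castAdd]
  subst hpq
  refine ⟨rfl, Equiv.ext fun b => (missedValues p).injective ?_⟩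
  rw [← prefixPerm_natAdd, h, prefixPerm_natAdd]

/-- A strictly increasing map hits values below `j` exactly on an initial segment. -/
lemma lt_iff_lt_card_of_strictMono {n N : ℕ} (e : Fin n ↪o Fin N) (j : ℕ) (c : Fin n) :
    (e c).val < j ↔ c.val < #{b : Fin n | (e b).val < j} := by
  constructor
  · intro h
    have hsub : Iic c ⊆ ({b : Fin n | (e b).val < j} : Finset (Fin n)) := by
      intro b hb
      simp only [mem_Iic, mem_filter, mem_univ, true_and] at hb ⊢
      exact lt_of_le_of_lt (Fin.le_def.1 (e.monotone hb)) h
    have := card_le_card hsub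
    rw [Fin.card_Iic] at this
    omega
  · intro h
    by_contra hcon
    have hsub : ({b : Fin n | (e b).val < j} : Finset (Fin n)) ⊆ Iio c := by
      intro b hb
      simp only [mem_Iio, mem_filter, mem_univ, true_and] at hb ⊢
      by_contra hcb
      exact hcon (lt_of_le_of_lt (Fin.le_def.1 (e.monotone (not_lt.1 hcb))) hb)
    have := card_le_card hsub
    rw [Fin.card_Iio] at this
    omega

lemma cornerCount_prefixPerm {k n : ℕ} (p : Fin k ↪ Fin (k + n)) (τ : Equiv.Perm (Fin n))
    (i j : ℕ) : cornerCount (prefixPerm p τ) i j =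
      prefixHits p i j + cornerCount τ (i - k) #{b : Fin n | (missedValues p b).val < j} := by
  unfold cornerCount prefixHits
  simp only [card_filter]
  rw [Fin.sum_univ_add]
  congr 1
  · simp only [prefixPerm_castAdd, Fin.val_castAdd]
  · refine sum_congr rfl fun b _ => ?_
    refine if_congr ?_ rfl rfl
    rw [prefixPerm_natAdd, lt_iff_lt_card_of_strictMono, card_filter, Fin.val_natAdd]
    exact and_congr_left' (by omega)

lemma prefixHits_add_card_missedValues {k n : ℕ} (p : Fin k ↪ Fin (k + n)) (j : ℕ) :
    prefixHits p k j + #{b : Fin n | (missedValues p b).val < j} =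
      #{x : Fin (k + n) | x.val < j} := by
  have h : #{x : Fin (k + n) | x.val < j} =
      #{a : Fin (k + n) | (prefixPerm p 1 a).val < j} := by
    simp only [card_filter]
    exact (Equiv.sum_comp (prefixPerm p 1) fun x : Fin (k + n) => if x.val < j then 1 else 0).symm
  rw [h]
  unfold prefixHits
  simp only [card_filter, Fin.sum_univ_add, prefixPerm_castAdd, prefixPerm_natAdd, Fin.is_lt,
    true_and, Equiv.Perm.one_apply]

lemma cornerCount_le_add {n : ℕ} (π : Equiv.Perm (Fin n)) (i : ℕ) {t j : ℕ} (h : t ≤ j) :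
    cornerCount π i j ≤ cornerCount π i t + (j - t) := by
  rw [cornerCount_split π i h, ← Nat.card_Ico t j]
  gcongr
  refine card_le_card_of_injOn (fun c => (π c).val) ?_ ?_
  · intro c hc
    simp only [coe_filter, mem_univ, true_and, Set.mem_ofPred_eq] at hc
    simp only [coe_Ico, Set.mem_Ico]
    exact hc.2
  · exact fun a _ b _ hab => π.injective (Fin.ext hab)

lemma prefixHits_of_le {k N : ℕ} (p : Fin k → Fin N) {i : ℕ} (h : k ≤ i) (j : ℕ) :
    prefixHits p i j = prefixHits p k j := by
  unfold prefixHits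
  congr 1
  ext l
  have := l.isLt
  simp only [mem_filter, mem_univ, true_and]
  omega

/-- If the prefix `p` dominates the prefix `q`, then prefixing preserves the corner order. -/
lemma CornerLE.prefixPerm {k n : ℕ} {p q : Fin k ↪ Fin (k + n)} {τ τ' : Equiv.Perm (Fin n)}
    (hpq : ∀ i j, prefixHits q i j ≤ prefixHits p i j) (h : CornerLE τ τ') :
    CornerLE (prefixPerm p τ) (prefixPerm q τ') := by
  intro i j
  rw [cornerCount_prefixPerm, cornerCount_prefixPerm]
  rcases le_or_gt i k with hi | hi
  · have h0 : ∀ (τ : Equiv.Perm (Fin n)) (t : ℕ), cornerCount τ (i - k) t = 0 := by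
      intro τ t
      simp [cornerCount, Nat.sub_eq_zero_of_le hi]
    rw [h0, h0]
    exact hpq i j
  · have hp := prefixHits_add_card_missedValues p j
    have hq := prefixHits_add_card_missedValues q j
    have hk := hpq k j
    rw [prefixHits_of_le p hi.le, prefixHits_of_le q hi.le]
    have h1 := h (i - k) #{b : Fin n | (missedValues q b).val < j}
    have h2 := cornerCount_le_add τ (i - k)
      (show #{b : Fin n | (missedValues p b).val < j} ≤
        #{b : Fin n | (missedValues q b).val < j} by omega)
    omega

open Classical in
/-- Dominating pairs of prefixes multiply the number of comparable pairs. -/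
lemma card_dominant_prefixes_mul_le (k n : ℕ) :
    #{d : (Fin k ↪ Fin (k + n)) × (Fin k ↪ Fin (k + n)) |
        ∀ i j, prefixHits d.2 i j ≤ prefixHits d.1 i j} * comparablePairs n ≤
      comparablePairs (k + n) := by
  unfold comparablePairs
  rw [← card_product]
  refine card_le_card_of_injOn
    (fun x => (_root_.prefixPerm x.1.1 x.2.1, _root_.prefixPerm x.1.2 x.2.2)) ?_ ?_
  · rintro ⟨⟨p, q⟩, τ, τ'⟩ hx
    simp only [coe_product, coe_filter, mem_univ, true_and, Set.mem_prod, Set.mem_ofPred_eq]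
      at hx ⊢
    exact CornerLE.prefixPerm hx.1 hx.2
  · rintro ⟨⟨p, q⟩, τ, τ'⟩ - ⟨⟨p', q'⟩, τ₁, τ₁'⟩ - h
    simp only [Prod.mk.injEq] at h
    obtain ⟨rfl, rfl⟩ := prefixPerm_injective h.1
    obtain ⟨rfl, rfl⟩ := prefixPerm_injective h.2
    rfl

/-! ### Placing words in cells -/

/-- The injection sending `l` into the cell number `u l` of length `s`, at offset `t l`. -/
def cellPlacement {k s N : ℕ} (u : Fin k → ℕ) (t : Fin k ↪ Fin s)
    (h : ∀ l, (u l + 1) * s ≤ N) : Fin k ↪ Fin N where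
  toFun l := ⟨u l * s + (t l).val, by have := h l; have := (t l).isLt; rw [add_mul] at *; omega⟩
  inj' a b hab := by
    simp only [Fin.mk.injEq] at hab
    have := congrArg (· % s) hab
    simp only [Nat.mul_add_mod', Nat.mod_eq_of_lt (Fin.isLt _)] at this
    exact t.injective (Fin.ext this)

lemma cellPlacement_val {k s N : ℕ} (u : Fin k → ℕ) (t : Fin k ↪ Fin s)
    (h : ∀ l, (u l + 1) * s ≤ N) (l : Fin k) :
    (cellPlacement u t h l).val = u l * s + (t l).val := rfl

lemma cellPlacement_injective {k s N : ℕ} {u u' : Fin k → ℕ} {t t' : Fin k ↪ Fin s}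
    {h : ∀ l, (u l + 1) * s ≤ N} {h' : ∀ l, (u' l + 1) * s ≤ N}
    (he : cellPlacement u t h = cellPlacement u' t' h') : u = u' ∧ t = t' := by
  have hl : ∀ l, u l * s + (t l).val = u' l * s + (t' l).val := fun l =>
    congrArg Fin.val (DFunLike.congr_fun he l)
  constructor
  · funext l
    have := congrArg (· / s) (hl l)
    have hs : 0 < s := (Nat.zero_le _).trans_lt (t l).isLt
    simpa only [mul_comm _ s, Nat.mul_add_div hs, Nat.div_eq_of_lt (Fin.isLt _), add_zero]
      using this
  · ext l
    have := congrArg (· % s) (hl l)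
    simpa only [Nat.mul_add_mod', Nat.mod_eq_of_lt (Fin.isLt _)] using this

lemma walkHeight_thresholdStep {M k : ℕ} (c : ℕ) (w : Fin k → Fin M × Fin M) (i : ℕ) :
    walkHeight (thresholdStep c) w i =
      #{l : Fin k | l.val < i ∧ (w l).2.rev.val < c} -
        #{l : Fin k | l.val < i ∧ (w l).1.val < c} := by
  simp only [card_filter, walkHeight, thresholdStep]
  push_cast
  rw [← sum_sub_distrib]
  refine sum_congr rfl fun l _ => ?_
  by_cases h : l.val < i <;> simp [h]

/-- Shifting the dominated word by one cell makes up for the unknown positions inside the cells: the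
prefix placed along `u` dominates the one placed along `v + 1`. -/
lemma prefixHits_cellPlacement_le {M k s N : ℕ} {w : Fin k → Fin M × Fin M}
    (hw : ∀ c ∈ range (M + 1), StaysNonneg (thresholdStep c) w) (t t' : Fin k ↪ Fin s)
    (h : ∀ l, ((w l).2.rev.val + 1) * s ≤ N) (h' : ∀ l, ((w l).1.val + 1 + 1) * s ≤ N)
    (i j : ℕ) :
    prefixHits (cellPlacement (fun l => (w l).1.val + 1) t' h') i j ≤
      prefixHits (cellPlacement (fun l => (w l).2.rev.val) t h) i j := by
  rcases Nat.eq_zero_or_pos s with hs | hs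
  · subst hs
    have : IsEmpty (Fin k) := ⟨fun l => (t l).elim0⟩
    simp [prefixHits]
  rcases Nat.eq_zero_or_pos j with hj | hj
  · subst hj; simp [prefixHits]
  -- `c` is the number of cells lying entirely below `j`, capped at the number of letters.
  set c := min ((j - 1) / s) M with hc
  have hkey := hw c (mem_range.2 (by omega)) i
  rw [walkHeight_thresholdStep, sub_nonneg, Nat.cast_le] at hkey
  have hdiv : (j - 1) / s * s ≤ j - 1 := Nat.div_mul_le_self _ _
  refine le_trans (card_le_card ?_) (hkey.trans (card_le_card ?_))
  · intro l hl
    simp only [mem_filter, mem_univ, true_and] at hl ⊢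
    rw [cellPlacement_val] at hl
    refine ⟨hl.1, lt_min ?_ (w l).1.isLt⟩
    rw [← Nat.succ_le_iff, Nat.le_div_iff_mul_le hs]
    have := hl.2
    simp only [Nat.succ_eq_add_one]
    omega
  · intro l hl
    simp only [mem_filter, mem_univ, true_and] at hl ⊢
    rw [cellPlacement_val]
    refine ⟨hl.1, ?_⟩
    have h1 : (w l).2.rev.val + 1 ≤ (j - 1) / s := (lt_min_iff.1 hl.2).1
    have h2 := Nat.mul_le_mul_right s h1
    have h3 := (t l).isLt
    rw [add_mul] at h2
    omega

open Classical in
lemma card_dominant_words_mul_le {M k s N : ℕ} (hs : (M + 1) * s ≤ N) :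
    #{w : Fin k → Fin M × Fin M | ∀ c ∈ range (M + 1), StaysNonneg (thresholdStep c) w} *
        (s.descFactorial k * s.descFactorial k) ≤
      #{d : (Fin k ↪ Fin N) × (Fin k ↪ Fin N) |
        ∀ i j, prefixHits d.2 i j ≤ prefixHits d.1 i j} := by
  have hcard : s.descFactorial k * s.descFactorial k =
      #(univ : Finset ((Fin k ↪ Fin s) × (Fin k ↪ Fin s))) := by
    rw [card_univ, Fintype.card_prod, Fintype.card_embedding_eq, Fintype.card_fin,
      Fintype.card_fin]
  have hfit : ∀ u : ℕ, u ≤ M → (u + 1) * s ≤ N := fun u hu =>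
    (Nat.mul_le_mul_right s (by omega)).trans hs
  rw [hcard, ← card_product]
  refine card_le_card_of_injOn (fun x =>
    (cellPlacement (fun l => (x.1 l).2.rev.val) x.2.1 fun l => hfit _ (Fin.isLt _).le,
      cellPlacement (fun l => (x.1 l).1.val + 1) x.2.2 fun l => hfit _ (Fin.isLt _))) ?_ ?_
  · rintro ⟨w, t, t'⟩ hx
    simp only [coe_product, coe_filter, coe_univ, mem_univ, true_and, Set.mem_prod,
      Set.mem_ofPred_eq, Set.mem_univ, and_true] at hx ⊢
    exact prefixHits_cellPlacement_le hx t t' _ _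
  · rintro ⟨w, t, t'⟩ - ⟨w₁, t₁, t₁'⟩ - h
    simp only [Prod.mk.injEq] at h
    obtain ⟨hu, rfl⟩ := cellPlacement_injective h.1
    obtain ⟨hv, rfl⟩ := cellPlacement_injective h.2
    congr 1
    funext l
    have h1 := congrFun hu l
    have h2 := congrFun hv l
    refine Prod.ext (Fin.ext (by simpa using h2)) (Fin.rev_injective (Fin.ext h1))

/-! ### The lower bound -/

/-- The proportion of comparable pairs among all pairs of permutations of `Fin n`. -/
noncomputable def comparableRatio (n : ℕ) : ℝ :=
  comparablePairs n / (n.factorial : ℝ) ^ 2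

lemma comparableRatio_pos (n : ℕ) : 0 < comparableRatio n := by
  classical
  refine div_pos (Nat.cast_pos.2 (card_pos.2 ⟨(1, 1), ?_⟩)) (by positivity)
  simpa using CornerLE.refl _

/-- One step of the recursion for the lower bound, with `s` the common length of the `M + 1` cells. -/
lemma comparableRatio_add_ge (M k n s : ℕ) [NeZero M] (hs : (M + 1) * s ≤ k + n) (hk : k ≤ s)
    (hpos : 0 < k + n) :
    ((M : ℝ) ^ 2) ^ k / ((k : ℝ) + 1) ^ (M + 1) * ((((s : ℝ) - k) / (k + n)) ^ 2) ^ k *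
      comparableRatio n ≤ comparableRatio (k + n) := by
  classical
  have h1 := (Nat.mul_le_mul_right (comparablePairs n)
    (card_dominant_words_mul_le (M := M) (k := k) hs)).trans (card_dominant_prefixes_mul_le k n)
  have h2 := card_dominant_words_ge M k
  set W := #{w : Fin k → Fin M × Fin M | ∀ c ∈ range (M + 1), StaysNonneg (thresholdStep c) w}
  have h3 : ((s : ℝ) - k) ^ k ≤ s.descFactorial k := by
    have h := Nat.pow_sub_le_descFactorial s k
    calc ((s : ℝ) - k) ^ k ≤ ((s + 1 - k : ℕ) : ℝ) ^ k := by
          have hle : (k : ℝ) ≤ s := by exact_mod_cast hk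
          refine pow_le_pow_left₀ (by linarith) ?_ k
          rw [Nat.cast_sub (by omega)]
          push_cast; linarith
      _ ≤ _ := by exact_mod_cast h
  have h4 : ((k + n).factorial : ℝ) ≤ n.factorial * ((k : ℝ) + n) ^ k := by
    have ha := Nat.factorial_mul_descFactorial (show k ≤ k + n by omega)
    have hb := Nat.descFactorial_le_pow (k + n) k
    rw [Nat.add_sub_cancel_left] at ha
    rw [← ha]
    exact_mod_cast Nat.mul_le_mul_left _ hb
  have hsk : (0 : ℝ) ≤ (s : ℝ) - k := by
    have : (k : ℝ) ≤ s := by exact_mod_cast hk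
    linarith
  have hkn : (0 : ℝ) < (k : ℝ) + n := by exact_mod_cast hpos
  unfold comparableRatio
  rw [le_div_iff₀ (by positivity)]
  calc ((M : ℝ) ^ 2) ^ k / ((k : ℝ) + 1) ^ (M + 1) * ((((s : ℝ) - k) / (k + n)) ^ 2) ^ k *
      (comparablePairs n / (n.factorial : ℝ) ^ 2) * ((k + n).factorial : ℝ) ^ 2
      ≤ W * ((((s : ℝ) - k) / (k + n)) ^ 2) ^ k *
      (comparablePairs n / (n.factorial : ℝ) ^ 2) * (n.factorial * ((k : ℝ) + n) ^ k) ^ 2 := by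
        gcongr
    _ = W * (((s : ℝ) - k) ^ k * ((s : ℝ) - k) ^ k) * comparablePairs n := by
        have : (n.factorial : ℝ) ≠ 0 := by positivity
        rw [← pow_mul, div_pow, mul_comm 2 k, pow_mul, pow_mul]
        field_simp
    _ ≤ W * ((s.descFactorial k : ℝ) * s.descFactorial k) * comparablePairs n := by
        gcongr
    _ ≤ comparablePairs (k + n) := by exact_mod_cast h1

open Filter Topology in
/-- Six letters, hence seven cells, give the exponential rate `(6 / 7) ^ 2 > 0.708`. -/
lemma exists_block_length : ∃ k n₀ : ℕ, 0 < k ∧ ∀ n, n₀ ≤ n →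
    (0.708 : ℝ) ^ k * comparableRatio n ≤ comparableRatio (k + n) := by
  obtain ⟨k, hk0, hk⟩ : ∃ k : ℕ, 0 < k ∧
      (0.708 : ℝ) ^ k < ((6 : ℝ) ^ 2) ^ k / ((k : ℝ) + 1) ^ 7 * ((1 / 7 : ℝ) ^ 2) ^ k := by
    have hlim : Tendsto (fun k : ℕ => ((k + 1 : ℕ) : ℝ) ^ 7 * (0.97 : ℝ) ^ (k + 1)) atTop (𝓝 0) :=
      (tendsto_pow_const_mul_const_pow_of_lt_one 7 (by norm_num) (by norm_num)).comp
        (tendsto_add_atTop_nat 1)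
    have hev := (hlim.eventually (gt_mem_nhds (show (0 : ℝ) < 0.97 by norm_num))).and
      (eventually_gt_atTop 0)
    obtain ⟨k, hk, hk0⟩ := hev.exists
    refine ⟨k, hk0, ?_⟩
    have hk' : ((k : ℝ) + 1) ^ 7 * (0.97 : ℝ) ^ k < 1 := by
      push_cast at hk
      rw [pow_succ (0.97 : ℝ), ← mul_assoc] at hk
      linarith
    rw [div_mul_eq_mul_div, lt_div_iff₀ (by positivity), ← mul_pow]
    calc (0.708 : ℝ) ^ k * ((k : ℝ) + 1) ^ 7 ≤ (0.97 * (36 / 49)) ^ k * ((k : ℝ) + 1) ^ 7 := by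
          gcongr; norm_num
      _ = (((k : ℝ) + 1) ^ 7 * (0.97 : ℝ) ^ k) * (36 / 49) ^ k := by rw [mul_pow]; ring
      _ < 1 * (36 / 49) ^ k := by gcongr
      _ = (6 ^ 2 * (1 / 7) ^ 2 : ℝ) ^ k := by norm_num
  have hlim : Tendsto (fun n : ℕ => ((6 : ℝ) ^ 2) ^ k / ((k : ℝ) + 1) ^ 7 *
      ((1 / 7 - ((k : ℝ) + 1) / (k + n)) ^ 2) ^ k) atTop
      (𝓝 (((6 : ℝ) ^ 2) ^ k / ((k : ℝ) + 1) ^ 7 * ((1 / 7 - 0 : ℝ) ^ 2) ^ k)) := by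
    refine (((Tendsto.const_sub _ ?_).pow 2).pow k).const_mul _
    exact Tendsto.const_div_atTop
      (tendsto_atTop_add_const_left _ _ tendsto_natCast_atTop_atTop) _
  rw [sub_zero] at hlim
  obtain ⟨n₁, hn₁⟩ := eventually_atTop.1 (hlim.eventually (lt_mem_nhds hk))
  refine ⟨k, max n₁ (7 * k + 7), hk0, fun n hn => ?_⟩
  have hs := comparableRatio_add_ge 6 k n ((k + n) / 7) (Nat.mul_div_le _ _) (by omega) (by omega)
  refine le_trans ?_ hs
  refine mul_le_mul_of_nonneg_right ?_ (comparableRatio_pos n).le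
  refine (hn₁ n (le_of_max_le_left hn)).le.trans ?_
  have hkn : (0 : ℝ) < (k : ℝ) + n := by exact_mod_cast (show 0 < k + n by omega)
  have hn7 : (7 * k + 7 : ℝ) ≤ k + n := by
    exact_mod_cast (show 7 * k + 7 ≤ k + n by omega)
  have hfloor : ((k : ℝ) + n) / 7 - 1 ≤ ((k + n) / 7 : ℕ) := by
    have : ((k + n : ℕ) : ℝ) ≤ 7 * ((k + n) / 7 : ℕ) + 7 := by
      exact_mod_cast (show k + n ≤ 7 * ((k + n) / 7) + 7 by omega)
    push_cast at this ⊢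
    linarith
  have hle : 1 / 7 - ((k : ℝ) + 1) / (k + n) ≤ (((k + n) / 7 : ℕ) - (k : ℝ)) / (k + n) := by
    rw [le_div_iff₀ hkn, sub_mul, div_mul_cancel₀ _ hkn.ne']
    linarith
  have h0 : 0 ≤ 1 / 7 - ((k : ℝ) + 1) / (k + n) := by
    rw [sub_nonneg, div_le_iff₀ hkn]
    linarith
  have : (((6 : ℕ) : ℝ) ^ 2) ^ k = ((6 : ℝ) ^ 2) ^ k := by norm_num
  rw [this]
  gcongr

lemma comparableRatio_lower_bound :
    ∃ c : ℝ, 0 < c ∧ ∀ n, c * (0.708 : ℝ) ^ n ≤ comparableRatio n := by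
  obtain ⟨k, n₀, hk, hrec⟩ := exists_block_length
  obtain ⟨a, -, ha⟩ := exists_min_image (range (n₀ + k)) comparableRatio ⟨0, by simp; omega⟩
  refine ⟨comparableRatio a, comparableRatio_pos a, fun n => ?_⟩
  induction n using Nat.strong_induction_on with
  | _ n ih =>
    rcases lt_or_ge n (n₀ + k) with hn | hn
    · calc _ ≤ comparableRatio a * 1 := by
            refine mul_le_mul_of_nonneg_left ?_ (comparableRatio_pos a).le
            exact pow_le_one₀ (by norm_num) (by norm_num)
        _ ≤ _ := by rw [mul_one]; exact ha n (mem_range.2 hn)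
    · obtain ⟨m, rfl⟩ := Nat.exists_eq_add_of_le (show k ≤ n by omega)
      refine le_trans ?_ (hrec m (by omega))
      calc _ = (0.708 : ℝ) ^ k * (comparableRatio a * (0.708 : ℝ) ^ m) := by rw [pow_add]; ring
        _ ≤ _ := by gcongr; exact ih m (by omega)

/-! ### Counting pairs of subsets with prefix dominance -/

/-- The indicator of a Boolean, as an integer. -/
def boolInt (b : Bool) : ℤ := if b then 1 else 0

/-- The step of the walk comparing two Boolean words. -/
def pairStep (x : Bool × Bool) : ℤ := boolInt x.1 - boolInt x.2

open Classical in
/-- The pairs of Boolean words of length `m`, with `r` and `s` ones, such that every prefix of the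
first word has at least as many ones as that of the second. The counts `r` and `s` are
integers so that the recursion on the last letter needs no case distinction. -/
noncomputable def ballotWords (m : ℕ) (r s : ℤ) : Finset (Fin m → Bool × Bool) :=
  {w | StaysNonneg pairStep w ∧ ∑ l, boolInt (w l).1 = r ∧ ∑ l, boolInt (w l).2 = s}

/-- Binomial coefficients with an integer lower index, zero at negative ones. -/
def chooseInt (m : ℕ) (r : ℤ) : ℤ := if 0 ≤ r then (m.choose r.toNat : ℤ) else 0

lemma chooseInt_natCast (m r : ℕ) : chooseInt m r = m.choose r := by simp [chooseInt]

lemma chooseInt_nonneg (m : ℕ) (r : ℤ) : 0 ≤ chooseInt m r := by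
  unfold chooseInt; split_ifs <;> positivity

lemma chooseInt_zero (r : ℤ) : chooseInt 0 r = if r = 0 then 1 else 0 := by
  unfold chooseInt
  rcases lt_trichotomy r 0 with h | h | h
  · simp [h.ne, not_le.2 h]
  · simp [h]
  · rw [if_pos h.le, if_neg h.ne', Nat.choose_eq_zero_of_lt (by omega)]; rfl

lemma chooseInt_succ (m : ℕ) (r : ℤ) :
    chooseInt (m + 1) r = chooseInt m r + chooseInt m (r - 1) := by
  unfold chooseInt
  rcases lt_trichotomy r 0 with h | h | h
  · rw [if_neg (by omega), if_neg (by omega), if_neg (by omega)]; rfl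
  · subst h; simp
  · obtain ⟨k, rfl⟩ : ∃ k : ℕ, r = k + 1 := ⟨(r - 1).toNat, by omega⟩
    rw [if_pos (by omega), if_pos (by omega), if_pos (by omega)]
    have h1 : ((k : ℤ) + 1).toNat = k + 1 := by omega
    have h2 : ((k : ℤ) + 1 - 1).toNat = k := by omega
    rw [h1, h2, Nat.choose_succ_succ]
    push_cast; ring

/-- Among all pairs of words with `r` and `s` ones, `r + 1 ≥ s`, the reflection principle discards as
many as there are pairs with `r + 1` and `s - 1` ones. -/
lemma card_ballotWords_le (m : ℕ) : ∀ r s : ℤ, s ≤ r + 1 →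
    (#(ballotWords m r s) : ℤ) ≤
      chooseInt m r * chooseInt m s - chooseInt m (r + 1) * chooseInt m (s - 1) := by
  classical
  induction m with
  | zero =>
    intro r s hrs
    simp only [chooseInt_zero]
    have hle : #(ballotWords 0 r s) ≤ if r = 0 ∧ s = 0 then 1 else 0 := by
      unfold ballotWords
      split_ifs with h
      · exact (card_le_univ _).trans (by simp)
      · rw [Nat.le_zero, card_eq_zero, filter_eq_empty_iff]
        intro w _ hw
        simp only [univ_eq_empty, sum_empty] at hw
        exact h ⟨hw.2.1.symm, hw.2.2.symm⟩
    have hle' : (#(ballotWords 0 r s) : ℤ) ≤ if r = 0 ∧ s = 0 then 1 else 0 := by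
      exact_mod_cast hle
    refine hle'.trans ?_
    split_ifs <;> omega
  | succ m ih =>
    intro r s hrs
    rcases hrs.lt_or_eq with hlt | heq
    · have hcard : (#(ballotWords (m + 1) r s) : ℤ) ≤
          ∑ x : Bool × Bool, (#(ballotWords m (r - boolInt x.1) (s - boolInt x.2)) : ℤ) := by
        simp only [ballotWords, card_filter]
        push_cast
        rw [sum_words_snoc, sum_comm]
        refine sum_le_sum fun x _ => sum_le_sum fun w _ => ?_
        simp only [staysNonneg_snoc, Fin.sum_univ_castSucc, Fin.snoc_castSucc, Fin.snoc_last]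
        split_ifs with h h'
        · exact le_rfl
        · exact absurd ⟨h.1.1, by linarith [h.2.1], by linarith [h.2.2]⟩ h'
        · exact zero_le_one
        · exact le_rfl
      refine hcard.trans ?_
      have h1 := ih r s (by omega)
      have h2 := ih (r - 1) s (by omega)
      have h3 := ih r (s - 1) (by omega)
      have h4 := ih (r - 1) (s - 1) (by omega)
      simp only [Fintype.sum_prod_type, Fintype.sum_bool, boolInt, if_true, Bool.false_eq_true,
        if_false, sub_zero, chooseInt_succ]
      simp only [sub_add_cancel, add_sub_cancel_right] at h1 h2 h3 h4 ⊢
      linarith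
    · -- Here `s = r + 1`: the walk would end at `-1`, and the two products agree.
      subst heq
      have : ballotWords (m + 1) r (r + 1) = ∅ := by
        unfold ballotWords
        rw [filter_eq_empty_iff]
        rintro w - ⟨hw, h1, h2⟩
        have := hw (m + 1)
        rw [walkHeight_of_le _ _ le_rfl] at this
        simp only [pairStep, sum_sub_distrib, h1, h2] at this
        omega
      rw [this, add_sub_cancel_right, mul_comm]
      simp

lemma ballotWords_eq_empty {m : ℕ} {r s : ℤ} (h : r < s) : ballotWords m r s = ∅ := by
  classical
  unfold ballotWords
  rw [filter_eq_empty_iff]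
  rintro w - ⟨hw, h1, h2⟩
  have := hw m
  rw [walkHeight_of_le _ _ le_rfl] at this
  simp only [pairStep, sum_sub_distrib, h1, h2] at this
  omega

lemma card_ballotWords_le_choose (m r s : ℕ) :
    #(ballotWords m r s) ≤ m.choose r * m.choose s := by
  rcases lt_or_ge r s with h | h
  · rw [ballotWords_eq_empty (by exact_mod_cast h)]; simp
  · have h1 := card_ballotWords_le m r s (by omega)
    have h2 := mul_nonneg (chooseInt_nonneg m (r + 1)) (chooseInt_nonneg m (s - 1))
    rw [chooseInt_natCast, chooseInt_natCast] at h1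
    zify; linarith

/-- The ballot theorem for two words: dominance has probability at most
`(m + 1) (r - s + 1) / ((r + 1) (m - s + 1))`. -/
lemma card_ballotWords_mul_le {m r s : ℕ} (hsr : s ≤ r) (hr : r ≤ m) :
    (#(ballotWords m r s) : ℝ) * (((r : ℝ) + 1) * ((m : ℝ) - s + 1)) ≤
      m.choose r * m.choose s * (((m : ℝ) + 1) * ((r : ℝ) - s + 1)) := by
  have h1 := card_ballotWords_le m r s (by omega)
  have e1 : ((r : ℤ) + 1) * chooseInt m (r + 1) = m.choose r * (m - r) := by
    have := Nat.choose_succ_right_eq m r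
    have hc : chooseInt m (r + 1) = m.choose (r + 1) := by exact_mod_cast chooseInt_natCast m (r + 1)
    rw [hc, ← Nat.cast_sub hr]
    rw [mul_comm]
    exact_mod_cast this
  have e2 : ((m : ℤ) - s + 1) * chooseInt m (s - 1) = m.choose s * s := by
    rcases s with _ | s
    · simp [chooseInt]
    · have := Nat.choose_succ_right_eq m s
      have hc : chooseInt m ((s + 1 : ℕ) - 1) = m.choose s := by
        rw [← chooseInt_natCast]; congr 1; push_cast; ring
      rw [hc]
      zify [show s ≤ m by omega] at this
      push_cast
      linarith
  rw [chooseInt_natCast, chooseInt_natCast] at h1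
  have hpos : (0 : ℤ) ≤ ((r : ℤ) + 1) * ((m : ℤ) - s + 1) := by
    have : (s : ℤ) ≤ m := by exact_mod_cast hsr.trans hr
    exact mul_nonneg (by positivity) (by omega)
  have h2 := mul_le_mul_of_nonneg_right h1 hpos
  have h3 : (#(ballotWords m r s) : ℤ) * (((r : ℤ) + 1) * ((m : ℤ) - s + 1)) ≤
      m.choose r * m.choose s * (((m : ℤ) + 1) * ((r : ℤ) - s + 1)) := by
    refine h2.trans (le_of_eq ?_)
    calc _ = (m.choose r * m.choose s : ℤ) * (((r : ℤ) + 1) * ((m : ℤ) - s + 1)) -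
          (((r : ℤ) + 1) * chooseInt m (r + 1)) * (((m : ℤ) - s + 1) * chooseInt m (s - 1)) := by
          ring
      _ = _ := by rw [e1, e2]; ring
  exact_mod_cast h3

/-! ### The four corner quadrants of a permutation -/

/-- The word marking the positions whose value is below `m`. -/
def lowWord {n : ℕ} (m : ℕ) (π : Equiv.Perm (Fin n)) (a : Fin n) : Bool := decide ((π a).val < m)

lemma cornerCount_inv {n : ℕ} (π : Equiv.Perm (Fin n)) (i j : ℕ) :
    cornerCount π⁻¹ i j = cornerCount π j i := by
  unfold cornerCount
  refine card_bij' (fun a _ => π⁻¹ a) (fun a _ => π a) ?_ ?_ ?_ ?_ <;> intro a <;>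
    simp [and_comm]

lemma CornerLE.inv {n : ℕ} {π σ : Equiv.Perm (Fin n)} (h : CornerLE π σ) :
    CornerLE π⁻¹ σ⁻¹ := fun i j => by
  rw [cornerCount_inv, cornerCount_inv]; exact h j i

/-- The number of small values is the same for all permutations. -/
lemma card_lowWord {m m' : ℕ} (π : Equiv.Perm (Fin (m + m'))) :
    ∑ a, boolInt (lowWord m π a) = m := by
  unfold lowWord
  rw [Equiv.sum_comp π fun v => boolInt (decide (v.val < m)), Fin.sum_univ_add]
  simp [boolInt]

lemma walkHeight_pairStep {m : ℕ} (x y : Fin m → Bool) (i : ℕ) :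
    walkHeight pairStep (fun l => (x l, y l)) i =
      (∑ l, if l.val < i then boolInt (x l) else 0) - ∑ l, if l.val < i then boolInt (y l) else 0 := by
  unfold walkHeight pairStep
  rw [← sum_sub_distrib]
  exact sum_congr rfl fun l _ => by split_ifs <;> simp

lemma cornerCount_eq_sum_lowWord {m m' : ℕ} (π : Equiv.Perm (Fin (m + m'))) (i : ℕ) :
    (cornerCount π i m : ℤ) =
      (∑ l : Fin m, if l.val < i then boolInt (lowWord m π (Fin.castAdd m' l)) else 0) +
        ∑ b : Fin m', if m + b.val < i then boolInt (lowWord m π (Fin.natAdd m b)) else 0 := by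
  have h : (cornerCount π i m : ℤ) = ∑ a, if a.val < i then boolInt (lowWord m π a) else 0 := by
    simp only [cornerCount, card_filter, boolInt, lowWord, decide_eq_true_eq, ite_and]
    push_cast
    rfl
  rw [h, Fin.sum_univ_add]
  rfl

lemma cornerCount_eq_sum_lowWord_left {m m' : ℕ} (π : Equiv.Perm (Fin (m + m'))) {i : ℕ}
    (hi : i ≤ m) : (cornerCount π i m : ℤ) =
      ∑ l : Fin m, if l.val < i then boolInt (lowWord m π (Fin.castAdd m' l)) else 0 := by
  rw [cornerCount_eq_sum_lowWord, add_eq_left]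
  exact sum_eq_zero fun b _ => if_neg (by omega)

lemma sum_lowWord_left {m m' : ℕ} (π : Equiv.Perm (Fin (m + m'))) :
    ∑ l : Fin m, boolInt (lowWord m π (Fin.castAdd m' l)) = cornerCount π m m := by
  rw [cornerCount_eq_sum_lowWord_left π le_rfl]
  simp

lemma sum_lowWord_right_suffix {m m' : ℕ} (π : Equiv.Perm (Fin (m + m'))) {i : ℕ} (hi : i ≤ m') :
    (∑ l : Fin m', if l.val < i then boolInt (lowWord m π (Fin.natAdd m l.rev)) else 0) =
      m - cornerCount π (m + (m' - i)) m := by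
  rw [cornerCount_eq_sum_lowWord]
  have h := card_lowWord π
  rw [Fin.sum_univ_add] at h
  have h1 : (∑ l : Fin m, if l.val < m + (m' - i) then boolInt (lowWord m π (Fin.castAdd m' l)) else 0) =
      ∑ l : Fin m, boolInt (lowWord m π (Fin.castAdd m' l)) :=
    sum_congr rfl fun l _ => if_pos (by omega)
  have h2 : (∑ l : Fin m', if l.val < i then boolInt (lowWord m π (Fin.natAdd m l.rev)) else 0) =
      ∑ b : Fin m', if b.rev.val < i then boolInt (lowWord m π (Fin.natAdd m b)) else 0 := by
    rw [← Equiv.sum_comp Fin.revPerm]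
    simp
  have h3 : (∑ b : Fin m', if b.rev.val < i then boolInt (lowWord m π (Fin.natAdd m b)) else 0) +
      (∑ b : Fin m', if m + b.val < m + (m' - i) then boolInt (lowWord m π (Fin.natAdd m b)) else 0) =
      ∑ b : Fin m', boolInt (lowWord m π (Fin.natAdd m b)) := by
    rw [← sum_add_distrib]
    refine sum_congr rfl fun b _ => ?_
    have := b.isLt
    rw [Fin.val_rev]
    split_ifs <;> omega
  rw [h1, h2]
  linarith

/-- The word pairing the low words of `π` and `σ` on the first `m` positions. -/
def leftWord {m m' : ℕ} (π σ : Equiv.Perm (Fin (m + m'))) (l : Fin m) : Bool × Bool :=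
  (lowWord m π (Fin.castAdd m' l), lowWord m σ (Fin.castAdd m' l))

/-- The word pairing the low words of `σ` and `π` on the last `m'` positions, read from right to
left. The roles of `π` and `σ` are exchanged, since `σ` dominates there. -/
def rightWord {m m' : ℕ} (π σ : Equiv.Perm (Fin (m + m'))) (l : Fin m') : Bool × Bool :=
  (lowWord m σ (Fin.natAdd m l.rev), lowWord m π (Fin.natAdd m l.rev))

lemma staysNonneg_of_le_length {ι : Type*} {k : ℕ} {φ : ι → ℤ} {w : Fin k → ι}
    (h : ∀ i ≤ k, 0 ≤ walkHeight φ w i) : StaysNonneg φ w := by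
  intro i
  rcases le_total i k with hi | hi
  · exact h i hi
  · rw [walkHeight_of_le φ w hi, ← walkHeight_of_le φ w le_rfl]; exact h k le_rfl

lemma CornerLE.leftWord_mem {m m' : ℕ} {π σ : Equiv.Perm (Fin (m + m'))} (h : CornerLE π σ) :
    leftWord π σ ∈ ballotWords m (cornerCount π m m) (cornerCount σ m m) := by
  classical
  simp only [ballotWords, mem_filter, mem_univ, true_and]
  refine ⟨staysNonneg_of_le_length fun i hi => ?_, sum_lowWord_left π, sum_lowWord_left σ⟩
  unfold leftWord
  rw [walkHeight_pairStep, ← cornerCount_eq_sum_lowWord_left π hi,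
    ← cornerCount_eq_sum_lowWord_left σ hi, sub_nonneg]
  exact_mod_cast h i m

lemma sum_lowWord_right {m m' : ℕ} (π : Equiv.Perm (Fin (m + m'))) :
    ∑ l : Fin m', boolInt (lowWord m π (Fin.natAdd m l.rev)) = m - cornerCount π m m := by
  have := sum_lowWord_right_suffix π (le_refl m')
  simpa using this

lemma CornerLE.rightWord_mem {m m' : ℕ} {π σ : Equiv.Perm (Fin (m + m'))} (h : CornerLE π σ) :
    rightWord π σ ∈ ballotWords m' (m - cornerCount σ m m) (m - cornerCount π m m) := by
  classical
  simp only [ballotWords, mem_filter, mem_univ, true_and]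
  refine ⟨staysNonneg_of_le_length fun i hi => ?_, sum_lowWord_right σ, sum_lowWord_right π⟩
  unfold rightWord
  rw [walkHeight_pairStep, sum_lowWord_right_suffix π hi, sum_lowWord_right_suffix σ hi]
  have : (cornerCount σ (m + (m' - i)) m : ℤ) ≤ cornerCount π (m + (m' - i)) m := by
    exact_mod_cast h _ m
  linarith

lemma cornerCount_self_le {n m : ℕ} (π : Equiv.Perm (Fin n)) : cornerCount π m m ≤ m := by
  have : cornerCount π m m ≤ #(range m) := by
    refine card_le_card_of_injOn (fun a => a.val) ?_ (fun a _ b _ h => Fin.ext h)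
    intro a ha
    simp only [coe_filter, mem_univ, true_and, Set.mem_ofPred_eq] at ha
    simpa using ha.1
  simpa using this

/-- The number of permutations with given low words of `π` and `π⁻¹`, when `r` of the first `m`
positions have low values: each of the four blocks cut out by the halves of the positions and of the
values can be permuted freely. -/
def blockFactorial (m m' r : ℕ) : ℕ :=
  r.factorial * (m - r).factorial * ((m - r).factorial * (m' - (m - r)).factorial)

open Classical in
lemma card_same_lowWords_le {m m' : ℕ} (π₀ : Equiv.Perm (Fin (m + m'))) :
    #{π : Equiv.Perm (Fin (m + m')) | lowWord m π = lowWord m π₀ ∧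
        lowWord m π⁻¹ = lowWord m π₀⁻¹} ≤ blockFactorial m m' (cornerCount π₀ m m) := by
  -- Such a permutation differs from `π₀` by one preserving the colour of every position, the colour
  -- recording the halves containing the position and its value under `π₀`.
  let col : Fin (m + m') → Bool × Bool := fun a => (decide (a.val < m), lowWord m π₀ a)
  have hcard := DomMulAct.stabilizer_card col
  have hle : #{π : Equiv.Perm (Fin (m + m')) | lowWord m π = lowWord m π₀ ∧
      lowWord m π⁻¹ = lowWord m π₀⁻¹} ≤
      Fintype.card {g : Equiv.Perm (Fin (m + m')) // col ∘ g = col} := by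
    rw [Fintype.card_subtype]
    refine card_le_card_of_injOn (fun π => π₀⁻¹ * π) ?_ (fun a _ b _ h => mul_left_cancel h)
    intro π hπ
    simp only [coe_filter, mem_univ, true_and, Set.mem_ofPred_eq] at hπ ⊢
    funext a
    have h1 := congrFun hπ.1 a
    have h2 := congrFun hπ.2 (π a)
    have e1 : π⁻¹ (π a) = a := π.symm_apply_apply a
    have e2 : π₀ (π₀⁻¹ (π a)) = π a := π₀.apply_symm_apply (π a)
    simp only [lowWord, e1] at h1 h2
    simp only [col, Function.comp_apply, Equiv.Perm.mul_apply, lowWord, e2, Prod.mk.injEq]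
    exact ⟨h2.symm, h1⟩
  refine hle.trans (le_of_eq ?_)
  have hleft := sum_lowWord_left π₀
  have hright := sum_lowWord_right π₀
  have hrev : ∑ l : Fin m', boolInt (lowWord m π₀ (Fin.natAdd m l.rev)) =
      ∑ l : Fin m', boolInt (lowWord m π₀ (Fin.natAdd m l)) :=
    Equiv.sum_comp Fin.revPerm fun l => boolInt (lowWord m π₀ (Fin.natAdd m l))
  rw [hrev] at hright
  have hr := cornerCount_self_le (m := m) π₀
  set r := cornerCount π₀ m m
  have hsum : ∀ x : Bool × Bool, (Fintype.card {a // col a = x} : ℤ) =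
      (∑ l : Fin m, if x.1 = true ∧ lowWord m π₀ (Fin.castAdd m' l) = x.2 then 1 else 0) +
        ∑ b : Fin m', if x.1 = false ∧ lowWord m π₀ (Fin.natAdd m b) = x.2 then 1 else 0 := by
    rintro ⟨p, q⟩
    rw [Fintype.card_subtype, card_filter]
    push_cast
    rw [Fin.sum_univ_add]
    simp [col, Prod.ext_iff, eq_comm]
  have hnot : ∀ {k : ℕ} (x : Fin k → Bool),
      (∑ l, if x l = false then (1 : ℤ) else 0) = k - ∑ l, boolInt (x l) := by
    intro k x
    have : ∀ l, (if x l = false then (1 : ℤ) else 0) = 1 - boolInt (x l) := fun l => by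
      cases x l <;> simp [boolInt]
    simp [this]
  have htt : Fintype.card {a // col a = (true, true)} = r := by
    zify; rw [hsum]; simpa [boolInt] using hleft
  have htf : Fintype.card {a // col a = (true, false)} = m - r := by
    zify [hr]; rw [hsum]
    simp only [true_and, Bool.true_eq_false, false_and, if_false, sum_const_zero, add_zero, hnot,
      hleft]
  have hft : Fintype.card {a // col a = (false, true)} = m - r := by
    zify [hr]; rw [hsum]; simpa [boolInt] using hright
  have hff : Fintype.card {a // col a = (false, false)} = m' - (m - r) := by
    have h : (Fintype.card {a // col a = (false, false)} : ℤ) = m' - (m - r) := by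
      rw [hsum]
      simp only [true_and, Bool.false_eq_true, false_and, if_false, sum_const_zero, zero_add, hnot,
        hright]
    omega
  rw [hcard]
  simp only [Fintype.prod_prod_type, Fintype.prod_bool, htt, htf, hft, hff, blockFactorial]

lemma lowWord_eq_of_words_eq {m m' : ℕ} {π σ π₀ σ₀ : Equiv.Perm (Fin (m + m'))}
    (hl : leftWord π σ = leftWord π₀ σ₀) (hr : rightWord π σ = rightWord π₀ σ₀) :
    lowWord m π = lowWord m π₀ ∧ lowWord m σ = lowWord m σ₀ := by
  constructor <;> funext a <;> refine Fin.addCases (fun l => ?_) (fun b => ?_) a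
  · exact congrArg Prod.fst (congrFun hl l)
  · simpa [rightWord] using congrArg Prod.snd (congrFun hr b.rev)
  · exact congrArg Prod.snd (congrFun hl l)
  · simpa [rightWord] using congrArg Prod.fst (congrFun hr b.rev)

open Classical in
/-- Comparable pairs with `r` and `s` points in the top-left quadrants: given the four words, the
blocks of both permutations can be permuted freely. -/
lemma card_comparable_quadrant_le (m m' r s : ℕ) :
    #{p : Equiv.Perm (Fin (m + m')) × Equiv.Perm (Fin (m + m')) | CornerLE p.1 p.2 ∧
        cornerCount p.1 m m = r ∧ cornerCount p.2 m m = s} ≤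
      blockFactorial m m' r * blockFactorial m m' s *
        ((#(ballotWords m r s) * #(ballotWords m' (m - s) (m - r))) *
          (#(ballotWords m r s) * #(ballotWords m' (m - s) (m - r)))) := by
  set S : Finset (Equiv.Perm (Fin (m + m')) × Equiv.Perm (Fin (m + m'))) :=
    {p | CornerLE p.1 p.2 ∧ cornerCount p.1 m m = r ∧ cornerCount p.2 m m = s} with hS
  let f : Equiv.Perm (Fin (m + m')) × Equiv.Perm (Fin (m + m')) →
      ((Fin m → Bool × Bool) × (Fin m' → Bool × Bool)) ×
        ((Fin m → Bool × Bool) × (Fin m' → Bool × Bool)) := fun p =>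
    ((leftWord p.1 p.2, rightWord p.1 p.2), (leftWord p.1⁻¹ p.2⁻¹, rightWord p.1⁻¹ p.2⁻¹))
  have himage : S.image f ⊆ (ballotWords m r s ×ˢ ballotWords m' (m - s) (m - r)) ×ˢ
      (ballotWords m r s ×ˢ ballotWords m' (m - s) (m - r)) := by
    intro x hx
    obtain ⟨⟨π, σ⟩, hp, rfl⟩ := mem_image.1 hx
    simp only [hS, mem_filter, mem_univ, true_and] at hp
    obtain ⟨h, hr, hs⟩ := hp
    have h1 := h.leftWord_mem
    have h2 := h.rightWord_mem
    have h3 := h.inv.leftWord_mem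
    have h4 := h.inv.rightWord_mem
    rw [cornerCount_inv, cornerCount_inv] at h3 h4
    rw [hr, hs] at h1 h2 h3 h4
    simp only [f, mem_product]
    exact ⟨⟨h1, h2⟩, h3, h4⟩
  refine (card_le_mul_card_image (f := f) S (blockFactorial m m' r * blockFactorial m m' s)
    ?_).trans ?_
  · intro b hb
    obtain ⟨⟨π₀, σ₀⟩, hp, rfl⟩ := mem_image.1 hb
    simp only [hS, mem_filter, mem_univ, true_and] at hp
    obtain ⟨-, hr, hs⟩ := hp
    have hπ := card_same_lowWords_le π₀
    have hσ := card_same_lowWords_le σ₀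
    rw [hr] at hπ
    rw [hs] at hσ
    refine le_trans (card_le_card ?_) ((card_product _ _).trans_le (Nat.mul_le_mul hπ hσ))
    rintro ⟨π, σ⟩ hx
    simp only [mem_filter, mem_product, mem_univ, true_and, f, Prod.mk.injEq] at hx ⊢
    obtain ⟨-, ⟨h1, h2⟩, h3, h4⟩ := hx
    obtain ⟨e1, e2⟩ := lowWord_eq_of_words_eq h1 h2
    obtain ⟨e3, e4⟩ := lowWord_eq_of_words_eq h3 h4
    exact ⟨⟨e1, e3⟩, e2, e4⟩
  · refine Nat.mul_le_mul_left _ ((card_le_card himage).trans ?_)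
    simp only [card_product]
    exact le_rfl

lemma comparablePairs_le_sum (m m' : ℕ) :
    comparablePairs (m + m') ≤ ∑ r ∈ range (m + 1), ∑ s ∈ range (m + 1),
      blockFactorial m m' r * blockFactorial m m' s *
        ((#(ballotWords m r s) * #(ballotWords m' (m - s) (m - r))) *
          (#(ballotWords m r s) * #(ballotWords m' (m - s) (m - r)))) := by
  classical
  unfold comparablePairs
  rw [card_eq_sum_card_fiberwise (f := fun p => (cornerCount p.1 m m, cornerCount p.2 m m))
    (t := range (m + 1) ×ˢ range (m + 1)), sum_product]
  · refine sum_le_sum fun r _ => sum_le_sum fun s _ => ?_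
    refine le_trans (card_le_card ?_) (card_comparable_quadrant_le m m' r s)
    intro p hp
    simp only [mem_filter, mem_univ, true_and, Prod.mk.injEq] at hp ⊢
    exact hp
  · intro p _
    simp only [coe_product, Set.mem_prod, mem_coe, mem_range, Nat.lt_succ_iff]
    exact ⟨cornerCount_self_le _, cornerCount_self_le _⟩

/-! ### Moments of the hypergeometric distribution -/

/-- The unnormalized hypergeometric weight: the number of `m`-subsets of `m + m'` points with exactly
`r` of them among the first `m`. -/
def hyperWeight (m m' r : ℕ) : ℝ := m.choose r * m'.choose (m - r)

lemma hyperWeight_nonneg (m m' r : ℕ) : 0 ≤ hyperWeight m m' r := by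
  unfold hyperWeight; positivity

lemma sum_hyperWeight (m m' : ℕ) :
    ∑ r ∈ range (m + 1), hyperWeight m m' r = (m + m').choose m := by
  rw [Nat.add_choose_eq, Nat.sum_antidiagonal_eq_sum_range_succ_mk]
  simp [hyperWeight]

lemma hyperWeight_succ {m m' r : ℕ} (hm : m ≤ m') (hr : r < m) :
    hyperWeight m m' (r + 1) * ((r + 1) * ((m' : ℝ) - m + (r + 1))) =
      hyperWeight m m' r * ((m : ℝ) - r) ^ 2 := by
  obtain ⟨k, rfl⟩ := Nat.exists_eq_add_of_lt hr
  have h1 := Nat.choose_succ_right_eq (r + k + 1) r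
  have h2 := Nat.choose_succ_right_eq m' k
  have e1 : r + k + 1 - r = k + 1 := by omega
  have e2 : r + k + 1 - (r + 1) = k := by omega
  rw [e1] at h1
  have h1' : ((r + k + 1).choose (r + 1) : ℝ) * (r + 1) = (r + k + 1).choose r * (k + 1) := by
    exact_mod_cast h1
  have h2' : (m'.choose (k + 1) : ℝ) * (k + 1) = m'.choose k * (m' - k) := by
    rw [← Nat.cast_sub (by omega : k ≤ m')]
    exact_mod_cast h2
  unfold hyperWeight
  rw [e1, e2]
  push_cast
  calc _ = (((r + k + 1).choose (r + 1) : ℝ) * (r + 1)) * (m'.choose k * (m' - k)) := by ring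
    _ = _ := by rw [h1', ← h2']; ring

/-- Deviation of `r` from its hypergeometric mean `m² / (m + m')`. -/
noncomputable def hyperDev (m m' r : ℕ) : ℝ := r - (m : ℝ) ^ 2 / (m + m')

lemma hyperDev_succ (m m' r : ℕ) : hyperDev m m' (r + 1) = hyperDev m m' r + 1 := by
  unfold hyperDev; push_cast; ring

/-- Stein's identity for the hypergeometric distribution. -/
lemma sum_hyperWeight_stein {m m' : ℕ} (hm0 : 0 < m) (hm : m ≤ m') (f : ℕ → ℝ) :
    ((m : ℝ) + m') * ∑ r ∈ range (m + 1), hyperWeight m m' r * (hyperDev m m' r * f r) =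
      ∑ r ∈ range (m + 1), hyperWeight m m' r * (((m : ℝ) - r) ^ 2 * (f (r + 1) - f r)) := by
  have hpos : (0 : ℝ) < (m : ℝ) + m' := by positivity
  have hshift : ∑ r ∈ range (m + 1), hyperWeight m m' r * ((r * ((m' : ℝ) - m + r)) * f r) =
      ∑ r ∈ range (m + 1), hyperWeight m m' r * (((m : ℝ) - r) ^ 2 * f (r + 1)) := by
    rw [sum_range_succ', sum_range_succ]
    simp only [Nat.cast_zero, zero_mul, mul_zero, add_zero, sub_self, ne_eq, OfNat.ofNat_ne_zero,
      not_false_eq_true, zero_pow]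
    refine sum_congr rfl fun r hr => ?_
    have := hyperWeight_succ hm (mem_range.1 hr)
    push_cast
    rw [← mul_assoc, this, mul_assoc]
  have hdev : ∀ r, ((m : ℝ) + m') * hyperDev m m' r =
      r * ((m' : ℝ) - m + r) - ((m : ℝ) - r) ^ 2 := fun r => by
    unfold hyperDev; field_simp; ring
  simp only [mul_sub, sum_sub_distrib]
  rw [← hshift, mul_sum, ← sum_sub_distrib]
  refine sum_congr rfl fun r _ => ?_
  calc _ = hyperWeight m m' r * ((((m : ℝ) + m') * hyperDev m m' r) * f r) := by ring
    _ = _ := by rw [hdev]; ring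

lemma sum_hyperWeight_sq_le {m m' : ℕ} {g : ℕ → ℝ} (hg : ∀ r, 0 ≤ g r) :
    ∑ r ∈ range (m + 1), hyperWeight m m' r * (((m : ℝ) - r) ^ 2 * g r) ≤
      ((m : ℝ) + m') * (m * ∑ r ∈ range (m + 1), hyperWeight m m' r * g r) := by
  rw [← mul_assoc, mul_sum]
  refine sum_le_sum fun r hr => ?_
  have hr' : (r : ℝ) ≤ m := by exact_mod_cast Nat.lt_succ_iff.1 (mem_range.1 hr)
  have hr0 : (0 : ℝ) ≤ r := by positivity
  have hm'0 : (0 : ℝ) ≤ (m : ℝ) * m' := by positivity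
  have : ((m : ℝ) - r) ^ 2 ≤ ((m : ℝ) + m') * m := by nlinarith
  calc _ = ((m : ℝ) - r) ^ 2 * (hyperWeight m m' r * g r) := by ring
    _ ≤ _ := mul_le_mul_of_nonneg_right this (mul_nonneg (hyperWeight_nonneg _ _ _) (hg r))

/-- The fourth central moment of the hypergeometric distribution is `O(m²)`. -/
lemma sum_hyperWeight_dev_four_le {m m' : ℕ} (hm0 : 0 < m) (hm : m ≤ m') :
    ∑ r ∈ range (m + 1), hyperWeight m m' r * hyperDev m m' r ^ 4 ≤
      4 * (m : ℝ) ^ 2 * (m + m').choose m := by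
  have hpos : (0 : ℝ) < (m : ℝ) + m' := by positivity
  have hm1 : (1 : ℝ) ≤ m := by exact_mod_cast hm0
  have hA : (0 : ℝ) ≤ (m + m').choose m := by positivity
  have h1 : ∑ r ∈ range (m + 1), hyperWeight m m' r * hyperDev m m' r = 0 := by
    have := sum_hyperWeight_stein hm0 hm fun _ => 1
    simp only [sub_self, mul_zero, sum_const_zero, mul_one, mul_eq_zero, hpos.ne', false_or] at this
    exact this
  have h2 : ∑ r ∈ range (m + 1), hyperWeight m m' r * hyperDev m m' r ^ 2 ≤
      m * (m + m').choose m := by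
    have hst := sum_hyperWeight_stein hm0 hm (hyperDev m m')
    have hle := sum_hyperWeight_sq_le (m := m) (m' := m') (g := fun _ => 1) fun _ => zero_le_one
    simp only [hyperDev_succ, add_sub_cancel_left, ← sq] at hst
    rw [← hst] at hle
    simp only [mul_one, sum_hyperWeight] at hle
    exact le_of_mul_le_mul_left hle hpos
  have hst := sum_hyperWeight_stein hm0 hm fun r => hyperDev m m' r ^ 3
  have hle := sum_hyperWeight_sq_le (m := m) (m' := m')
    (g := fun r => 3 * hyperDev m m' r ^ 2 + 3 * hyperDev m m' r + 1)
    fun r => by nlinarith [sq_nonneg (2 * hyperDev m m' r + 1), sq_nonneg (hyperDev m m' r)]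
  have hcube : ∀ r, hyperDev m m' (r + 1) ^ 3 - hyperDev m m' r ^ 3 =
      3 * hyperDev m m' r ^ 2 + 3 * hyperDev m m' r + 1 := fun r => by rw [hyperDev_succ]; ring
  simp only [hcube, ← pow_succ'] at hst
  rw [← hst] at hle
  have hle' := le_of_mul_le_mul_left hle hpos
  have hsplit : ∑ r ∈ range (m + 1),
      hyperWeight m m' r * (3 * hyperDev m m' r ^ 2 + 3 * hyperDev m m' r + 1) =
      3 * ∑ r ∈ range (m + 1), hyperWeight m m' r * hyperDev m m' r ^ 2 +
        3 * ∑ r ∈ range (m + 1), hyperWeight m m' r * hyperDev m m' r + (m + m').choose m := by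
    rw [← sum_hyperWeight, mul_sum, mul_sum, ← sum_add_distrib, ← sum_add_distrib]
    exact sum_congr rfl fun r _ => by ring
  rw [hsplit, h1] at hle'
  have h3 : (m : ℝ) * (3 * ∑ r ∈ range (m + 1), hyperWeight m m' r * hyperDev m m' r ^ 2 +
      3 * 0 + (m + m').choose m) ≤ m * (3 * (m * (m + m').choose m) + 3 * 0 +
        m * (m + m').choose m) := by
    gcongr
    exact le_mul_of_one_le_left hA hm1
  linarith

/-! ### The upper bound -/

lemma blockFactorial_mul_hyperWeight {m m' r : ℕ} (hr : r ≤ m) (hm : m ≤ m') :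
    (blockFactorial m m' r : ℝ) * hyperWeight m m' r = m.factorial * m'.factorial := by
  have h1 := Nat.choose_mul_factorial_mul_factorial hr
  have h2 := Nat.choose_mul_factorial_mul_factorial (show m - r ≤ m' by omega)
  rw [← h1, ← h2]
  unfold blockFactorial hyperWeight
  push_cast
  ring

/-- The ballot estimate for the two halves of the positions, in terms of deviations from the mean.
Where `r` and `s` are near the mean each of the two ballot factors is of order `(r - s + 1) / m`;
elsewhere the right-hand side is already of order one. -/
lemma ballot_mul_ballot_le {m m' r s : ℕ} (hm0 : 0 < m) (hm : m ≤ m') (hm' : m' ≤ m + 1)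
    (hr : r ≤ m) (hs : s ≤ m) :
    (m : ℝ) ^ 2 * (#(ballotWords m r s) * #(ballotWords m' (m - s) (m - r))) ≤
      2304 * (1 + |hyperDev m m' r| + |hyperDev m m' s|) ^ 2 *
        (hyperWeight m m' r * hyperWeight m m' s) := by
  have hw : 0 ≤ hyperWeight m m' r * hyperWeight m m' s :=
    mul_nonneg (hyperWeight_nonneg _ _ _) (hyperWeight_nonneg _ _ _)
  rcases lt_or_ge r s with hrs | hsr
  · rw [ballotWords_eq_empty (by exact_mod_cast hrs)]
    simp only [card_empty, Nat.cast_zero, zero_mul, mul_zero]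
    positivity
  have hcast : ((m : ℤ) - s = (m - s : ℕ)) ∧ ((m : ℤ) - r = (m - r : ℕ)) := by omega
  rw [hcast.1, hcast.2]
  set b₁ : ℝ := ((#(ballotWords m r s) : ℕ) : ℝ) with hb₁
  set b₂ : ℝ := ((#(ballotWords m' (m - s : ℕ) (m - r : ℕ)) : ℕ) : ℝ) with hb₂
  set z := 1 + |hyperDev m m' r| + |hyperDev m m' s| with hz
  have hb₁0 : 0 ≤ b₁ := Nat.cast_nonneg _
  have hb₂0 : 0 ≤ b₂ := Nat.cast_nonneg _
  have hm1 : (1 : ℝ) ≤ m := by exact_mod_cast hm0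
  have hmR : (m : ℝ) ≤ m' := by exact_mod_cast hm
  have hmR' : (m' : ℝ) ≤ m + 1 := by exact_mod_cast hm'
  have hrR : (r : ℝ) ≤ m := by exact_mod_cast hr
  have hsR : (s : ℝ) ≤ m := by exact_mod_cast hs
  have hsrR : (s : ℝ) ≤ r := by exact_mod_cast hsr
  have hr0 : (0 : ℝ) ≤ r := Nat.cast_nonneg _
  have hz1 : (r : ℝ) - s + 1 ≤ z := by
    have h1 := le_abs_self (hyperDev m m' r)
    have h2 := neg_le_abs (hyperDev m m' s)
    have h3 : hyperDev m m' r - hyperDev m m' s = r - s := by unfold hyperDev; ring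
    linarith
  have hz0 : 0 ≤ z := by positivity
  by_cases hgood : (m : ℝ) / 4 ≤ r + 1 ∧ (m : ℝ) / 4 ≤ m - s + 1
  · obtain ⟨hg1, hg2⟩ := hgood
    have hq : (m : ℝ) / 4 * (m / 4) ≤ (r + 1) * (m - s + 1) :=
      mul_le_mul hg1 hg2 (by positivity) (by positivity)
    have h1 : b₁ * ((m : ℝ) / 4 * (m / 4)) ≤ m.choose r * m.choose s * (3 * m * z) := by
      refine (mul_le_mul_of_nonneg_left hq hb₁0).trans ((card_ballotWords_mul_le hsr hr).trans ?_)
      have : ((m : ℝ) + 1) * (r - s + 1) ≤ 3 * m * z :=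
        mul_le_mul (by linarith) hz1 (by linarith) (by positivity)
      gcongr
    have h2 : b₂ * ((m : ℝ) / 4 * (m / 4)) ≤
        m'.choose (m - s) * m'.choose (m - r) * (3 * m * z) := by
      have h := card_ballotWords_mul_le (m := m') (r := m - s) (s := m - r)
        (by omega) (by omega)
      rw [Nat.cast_sub (R := ℝ) hs, Nat.cast_sub (R := ℝ) hr] at h
      have hq' : (m : ℝ) / 4 * (m / 4) ≤ ((m : ℝ) - s + 1) * (m' - (m - r) + 1) :=
        mul_le_mul hg2 (by linarith) (by positivity) (by linarith)
      refine (mul_le_mul_of_nonneg_left hq' hb₂0).trans (h.trans ?_)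
      have : ((m' : ℝ) + 1) * ((m - s) - (m - r) + 1) ≤ 3 * m * z :=
        mul_le_mul (by linarith) (by linarith) (by linarith) (by positivity)
      gcongr
    have h3 := mul_le_mul h1 h2 (by positivity) (by positivity)
    have hmsq : (0 : ℝ) < m ^ 2 := by positivity
    refine le_of_mul_le_mul_left ?_ hmsq
    unfold hyperWeight
    calc _ = 256 * (b₁ * ((m : ℝ) / 4 * (m / 4)) * (b₂ * ((m : ℝ) / 4 * (m / 4)))) := by ring
      _ ≤ 256 * (m.choose r * m.choose s * (3 * m * z) *
          (m'.choose (m - s) * m'.choose (m - r) * (3 * m * z))) := by gcongr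
      _ = _ := by ring
  · have hb : b₁ * b₂ ≤ hyperWeight m m' r * hyperWeight m m' s := by
      have h1 : b₁ ≤ m.choose r * m.choose s := by
        rw [hb₁]; exact_mod_cast card_ballotWords_le_choose m r s
      have h2 : b₂ ≤ m'.choose (m - s) * m'.choose (m - r) := by
        rw [hb₂]; exact_mod_cast card_ballotWords_le_choose m' (m - s) (m - r)
      refine (mul_le_mul h1 h2 hb₂0 (by positivity)).trans (le_of_eq ?_)
      unfold hyperWeight; ring
    have hmean_le : (m : ℝ) ^ 2 / (m + m') ≤ m / 2 := by
      rw [div_le_iff₀ (by positivity)]; nlinarith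
    have hmean_ge : (m : ℝ) / 2 - 1 / 4 ≤ (m : ℝ) ^ 2 / (m + m') := by
      rw [le_div_iff₀ (by positivity)]; nlinarith
    have hzm : (m : ℝ) / 4 ≤ z := by
      rw [not_and_or, not_le, not_le] at hgood
      rcases hgood with h | h
      · have := neg_le_abs (hyperDev m m' r)
        have := abs_nonneg (hyperDev m m' s)
        have : hyperDev m m' r = r - (m : ℝ) ^ 2 / (m + m') := rfl
        linarith
      · have := le_abs_self (hyperDev m m' s)
        have := abs_nonneg (hyperDev m m' r)
        have : hyperDev m m' s = s - (m : ℝ) ^ 2 / (m + m') := rfl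
        linarith
    have hsq : (m : ℝ) ^ 2 ≤ 2304 * z ^ 2 := by nlinarith
    exact mul_le_mul hsq hb (by positivity) (by positivity)

lemma add_pow_four_le (x y : ℝ) : (1 + |x| + |y|) ^ 4 ≤ 27 * (1 + x ^ 4 + y ^ 4) := by
  have h : ∀ a b c : ℝ, (a + b + c) ^ 2 ≤ 3 * (a ^ 2 + b ^ 2 + c ^ 2) := fun a b c => by
    nlinarith [sq_nonneg (a - b), sq_nonneg (b - c), sq_nonneg (a - c)]
  have h1 := h 1 |x| |y|
  have h2 := h 1 (x ^ 2) (y ^ 2)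
  rw [sq_abs, sq_abs] at h1
  calc (1 + |x| + |y|) ^ 4 = ((1 + |x| + |y|) ^ 2) ^ 2 := by ring
    _ ≤ (3 * (1 ^ 2 + x ^ 2 + y ^ 2)) ^ 2 := by gcongr
    _ = 9 * (1 + x ^ 2 + y ^ 2) ^ 2 := by ring
    _ ≤ 9 * (3 * (1 ^ 2 + (x ^ 2) ^ 2 + (y ^ 2) ^ 2)) := by gcongr
    _ = _ := by ring

/-- The ballot estimate for one pair of quadrant counts: the square comes from using both the
positions and the values. -/
lemma quadrant_term_le {m m' r s : ℕ} (hm0 : 0 < m) (hm : m ≤ m') (hm' : m' ≤ m + 1)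
    (hr : r ≤ m) (hs : s ≤ m) :
    (m : ℝ) ^ 4 * (blockFactorial m m' r * blockFactorial m m' s *
        ((#(ballotWords m r s) * #(ballotWords m' (m - s) (m - r))) *
          (#(ballotWords m r s) * #(ballotWords m' (m - s) (m - r))))) ≤
      2304 ^ 2 * 27 * ((m.factorial : ℝ) * m'.factorial) ^ 2 *
        (hyperWeight m m' r * hyperWeight m m' s *
          (1 + hyperDev m m' r ^ 4 + hyperDev m m' s ^ 4)) := by
  have h := ballot_mul_ballot_le hm0 hm hm' hr hs
  set b : ℝ := #(ballotWords m r s) * #(ballotWords m' (m - s) (m - r)) with hb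
  have hb0 : 0 ≤ b := by positivity
  set z := 1 + |hyperDev m m' r| + |hyperDev m m' s| with hz
  have hwr := hyperWeight_nonneg m m' r
  have hws := hyperWeight_nonneg m m' s
  have hsq := pow_le_pow_left₀ (by positivity) h 2
  calc _ = (blockFactorial m m' r * blockFactorial m m' s : ℝ) * ((m : ℝ) ^ 2 * b) ^ 2 := by ring
    _ ≤ (blockFactorial m m' r * blockFactorial m m' s : ℝ) *
        (2304 * z ^ 2 * (hyperWeight m m' r * hyperWeight m m' s)) ^ 2 := by gcongr
    _ = 2304 ^ 2 * ((blockFactorial m m' r * hyperWeight m m' r) *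
          (blockFactorial m m' s * hyperWeight m m' s)) *
          (hyperWeight m m' r * hyperWeight m m' s * z ^ 4) := by ring
    _ ≤ 2304 ^ 2 * (((m.factorial : ℝ) * m'.factorial) * ((m.factorial : ℝ) * m'.factorial)) *
          (hyperWeight m m' r * hyperWeight m m' s *
            (27 * (1 + hyperDev m m' r ^ 4 + hyperDev m m' s ^ 4))) := by
        rw [blockFactorial_mul_hyperWeight hr hm, blockFactorial_mul_hyperWeight hs hm]
        gcongr
        exact add_pow_four_le _ _
    _ = _ := by ring

lemma comparableRatio_halves_le {m m' : ℕ} (hm0 : 0 < m) (hm : m ≤ m') (hm' : m' ≤ m + 1) :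
    comparableRatio (m + m') ≤ 2304 ^ 2 * 243 / (m : ℝ) ^ 2 := by
  have hm1 : (1 : ℝ) ≤ m := by exact_mod_cast hm0
  have hN := Nat.cast_le (α := ℝ).2 (comparablePairs_le_sum m m')
  push_cast at hN
  set A : ℝ := (((m + m').choose m : ℕ) : ℝ) with hA
  have hA0 : 0 ≤ A := by positivity
  set Q : ℝ := (m.factorial : ℝ) * m'.factorial with hQ
  have hfac : ((m + m').factorial : ℝ) = A * Q := by
    have := Nat.choose_mul_factorial_mul_factorial (show m ≤ m + m' by omega)
    rw [Nat.add_sub_cancel_left] at this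
    rw [← this, hA, hQ]
    push_cast; ring
  have hsum : ∑ r ∈ range (m + 1), ∑ s ∈ range (m + 1),
      (hyperWeight m m' r * hyperWeight m m' s *
        (1 + hyperDev m m' r ^ 4 + hyperDev m m' s ^ 4)) =
      A * A + 2 * (A * ∑ r ∈ range (m + 1), hyperWeight m m' r * hyperDev m m' r ^ 4) := by
    have e : ∀ r s, hyperWeight m m' r * hyperWeight m m' s *
        (1 + hyperDev m m' r ^ 4 + hyperDev m m' s ^ 4) =
        hyperWeight m m' r * hyperWeight m m' s +
          (hyperWeight m m' r * hyperDev m m' r ^ 4) * hyperWeight m m' s +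
          hyperWeight m m' r * (hyperWeight m m' s * hyperDev m m' s ^ 4) := fun r s => by ring
    simp only [e, sum_add_distrib]
    rw [← sum_mul_sum, ← sum_mul_sum, ← sum_mul_sum, sum_hyperWeight]
    ring
  have hmain : (m : ℝ) ^ 4 * comparablePairs (m + m') ≤
      2304 ^ 2 * 27 * Q ^ 2 * (A * A + 2 * (A * (4 * (m : ℝ) ^ 2 * A))) := by
    calc _ ≤ _ := mul_le_mul_of_nonneg_left hN (by positivity)
      _ ≤ 2304 ^ 2 * 27 * Q ^ 2 * ∑ r ∈ range (m + 1), ∑ s ∈ range (m + 1),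
          (hyperWeight m m' r * hyperWeight m m' s *
            (1 + hyperDev m m' r ^ 4 + hyperDev m m' s ^ 4)) := by
          simp only [mul_sum]
          refine sum_le_sum fun r hr => sum_le_sum fun s hs => ?_
          exact quadrant_term_le hm0 hm hm' (Nat.lt_succ_iff.1 (mem_range.1 hr))
            (Nat.lt_succ_iff.1 (mem_range.1 hs))
      _ ≤ _ := by
          rw [hsum]
          gcongr
          exact sum_hyperWeight_dev_four_le hm0 hm
  unfold comparableRatio
  rw [div_le_div_iff₀ (by positivity) (by positivity), hfac]
  have hm2 : (0 : ℝ) < (m : ℝ) ^ 2 := by positivity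
  refine le_of_mul_le_mul_left ?_ hm2
  calc _ = (m : ℝ) ^ 4 * comparablePairs (m + m') := by ring
    _ ≤ _ := hmain
    _ = 2304 ^ 2 * 27 * Q ^ 2 * (A * A) * (1 + 8 * (m : ℝ) ^ 2) := by ring
    _ ≤ 2304 ^ 2 * 27 * Q ^ 2 * (A * A) * (9 * (m : ℝ) ^ 2) := by
        gcongr
        nlinarith
    _ = _ := by ring

lemma comparableRatio_le_one (n : ℕ) : comparableRatio n ≤ 1 := by
  classical
  unfold comparableRatio comparablePairs
  rw [div_le_one (by positivity)]
  have h := card_le_univ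
    ({p | CornerLE p.1 p.2} : Finset (Equiv.Perm (Fin n) × Equiv.Perm (Fin n)))
  rw [Fintype.card_prod, Fintype.card_perm, Fintype.card_fin, ← sq] at h
  exact_mod_cast h

lemma comparableRatio_upper_bound {n : ℕ} (hn : 1 ≤ n) :
    comparableRatio n ≤ 2304 ^ 2 * 2187 / (n : ℝ) ^ 2 := by
  rcases hn.eq_or_lt with rfl | hn2
  · exact (comparableRatio_le_one 1).trans (by norm_num)
  have hsplit : n / 2 + (n - n / 2) = n := by omega
  have h := comparableRatio_halves_le (m := n / 2) (m' := n - n / 2) (by omega) (by omega)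
    (by omega)
  rw [hsplit] at h
  refine h.trans ?_
  have hm : (0 : ℝ) < (n / 2 : ℕ) := by exact_mod_cast (show 0 < n / 2 by omega)
  have hn3 : (n : ℝ) ≤ 3 * (n / 2 : ℕ) := by exact_mod_cast (show n ≤ 3 * (n / 2) by omega)
  have hn0 : (0 : ℝ) < n := by exact_mod_cast hn
  rw [div_le_div_iff₀ (by positivity) (by positivity)]
  have : (n : ℝ) ^ 2 ≤ (3 * (n / 2 : ℕ)) ^ 2 := by gcongr
  linarith

theorem theorem1 :
    ∃ c₁ c₂ : ℝ, 0 < c₁ ∧ 0 < c₂ ∧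
      ∀ (n : ℕ), 1 ≤ n →
      ∀ (Ω : Type*) [MeasurableSpace Ω] (P : MeasureTheory.Measure Ω)
        [MeasureTheory.IsProbabilityMeasure P] (π σ : Ω → Equiv.Perm (Fin n)),
        IsUniformPerm P π → IsUniformPerm P σ → ProbabilityTheory.IndepFun π σ P →
        c₁ * (0.708 : ℝ) ^ n ≤ P.real {x | BruhatLE (π x) (σ x)} ∧
        P.real {x | BruhatLE (π x) (σ x)} ≤ c₂ / (n : ℝ) ^ 2 := by
  obtain ⟨c, hc, hlow⟩ := comparableRatio_lower_bound
  refine ⟨c, 2304 ^ 2 * 2187, hc, by norm_num, ?_⟩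
  intro n hn Ω _ P _ π σ hπ hσ hind
  have hP : P.real {x | BruhatLE (π x) (σ x)} = comparableRatio n :=
    measureReal_bruhatLE hπ hσ hind
  rw [hP]
  exact ⟨hlow n, comparableRatio_upper_bound hn⟩
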